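/- Let $\mathbb F$ be a finite field. Algebras are vector spaces over $\mathbb F$ with a bilinear product, not necessarily associative or unital. For an algebra $P$ and $k\ge 1$ let $P^k$ be the linear span of the values in $P$ of all nonassociative monomials of degree $k$ (an ideal), let $I(P)=\{x\in P : ax=xa=0 \text{ for all } a\in P\}$, and let $\mathfrak N_k$ be the class of all algebras with $P^{k+1}=\{0\}$. A primitive class is the class of all algebras satisfying a nonempty set of identities $v(x_1,\dots,x_m)=0$, where the $v$ are nonassociative polynomials. The free algebra $F_n(\mathfrak V)$ of rank $n$ of a primitive class $\mathfrak V$ is the quotient of the absolutely free nonassociative algebra on $n$ generators by the ideal generated by all values of the identities of $\mathfrak V$. Let $c\ge 2$ and let $\mathfrak V$ be a primitive class that is $c$-step nilpotent (that is, $\mathfrak V\subset\mathfrak N_c$ and $\mathfrak V\not\subset\mathfrak N_{c-1}$) and central, that is, $I(F_n(\mathfrak V))=F_n(\mathfrak V)^c$ for all $n\ge 2$. Let $\mathfrak V'=\mathfrak V\cap\mathfrak N_{c-1}$. For each $n$ let $S_n$ be the set of isomorphism classes of algebras in $\mathfrak V$ that can be generated by $n$ elements, and let $T_n\subset S_n$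 be the set of the classes of those $P$ for which $P/P^c$ is isomorphic to the free algebra $F_n(\mathfrak V')$ of rank $n$. Then every $S_n$ is finite and $$\lim_{n\to\infty}\frac{|T_n|}{|S_n|}=1 .$$ Moreover the convergence is exponential: there is a real number $r$ with $0\le r<1$ such that $|T_n|/|S_n|>1-r^n$ for all sufficiently large $n$. -/

import Mathlib

open Filter Topology

universe u v

noncomputable section

namespace NilpotentGeneric

/-! ### Nonassociative algebras, ideals and quotients -/

/-- A (not necessarily associative, not necessarily unital) algebra over the field `𝔽`. -/
structure NAlg (𝔽 : Type u) [Field 𝔽] where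
  carrier : Type u
  [ring : NonUnitalNonAssocRing carrier]
  [module : Module 𝔽 carrier]
  [isScalarTower : IsScalarTower 𝔽 carrier carrier]
  [smulCommClass : SMulCommClass 𝔽 carrier carrier]

attribute [instance] NAlg.ring NAlg.module NAlg.isScalarTower NAlg.smulCommClass

section Unbundled

variable (𝔽 : Type u) [Field 𝔽]
variable (P : Type v) [NonUnitalNonAssocRing P] [Module 𝔽 P]

/-- A two-sided ideal of a nonassociative algebra. -/
@[ext]
structure AlgIdeal extends Submodule 𝔽 P where
  mul_mem_left' : ∀ (a : P) {x : P}, x ∈ carrier → a * x ∈ carrier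
  mul_mem_right' : ∀ {x : P} (a : P), x ∈ carrier → x * a ∈ carrier

variable {𝔽 P}

/-- The quotient `P / I` of an algebra by a two-sided ideal. -/
def AlgIdeal.Quot (I : AlgIdeal 𝔽 P) : Type v := P ⧸ I.toSubmodule

namespace AlgIdeal

variable (I : AlgIdeal 𝔽 P)

instance : AddCommGroup I.Quot := inferInstanceAs (AddCommGroup (P ⧸ I.toSubmodule))

instance : Module 𝔽 I.Quot := inferInstanceAs (Module 𝔽 (P ⧸ I.toSubmodule))

/-- The canonical projection `P → P / I`. -/
def proj : P →ₗ[𝔽] I.Quot := I.toSubmodule.mkQ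

theorem proj_surjective : Function.Surjective I.proj := I.toSubmodule.mkQ_surjective

theorem proj_eq_proj {x y : P} : I.proj x = I.proj y ↔ x - y ∈ I.toSubmodule :=
  Submodule.Quotient.eq I.toSubmodule

instance : Mul I.Quot where
  mul := Quotient.map₂ (· * ·) <| by
    intro a a' ha b b' hb
    have ha' : a - a' ∈ I.toSubmodule := (Submodule.quotientRel_def _).1 ha
    have hb' : b - b' ∈ I.toSubmodule := (Submodule.quotientRel_def _).1 hb
    refine (Submodule.quotientRel_def _).2 ?_
    have h : a * b - a' * b' = (a - a') * b + a' * (b - b') := by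
      rw [sub_mul, mul_sub]; abel
    change a * b - a' * b' ∈ I.toSubmodule
    rw [h]
    exact I.toSubmodule.add_mem (I.mul_mem_right' b ha') (I.mul_mem_left' a' hb')

theorem proj_mul (x y : P) : I.proj (x * y) = I.proj x * I.proj y := rfl

instance : NonUnitalNonAssocRing I.Quot where
  left_distrib a b c := by
    obtain ⟨a, rfl⟩ := I.proj_surjective a
    obtain ⟨b, rfl⟩ := I.proj_surjective b
    obtain ⟨c, rfl⟩ := I.proj_surjective c
    rw [← map_add, ← proj_mul, ← proj_mul, ← proj_mul, ← map_add, mul_add]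
  right_distrib a b c := by
    obtain ⟨a, rfl⟩ := I.proj_surjective a
    obtain ⟨b, rfl⟩ := I.proj_surjective b
    obtain ⟨c, rfl⟩ := I.proj_surjective c
    rw [← map_add, ← proj_mul, ← proj_mul, ← proj_mul, ← map_add, add_mul]
  zero_mul a := by
    obtain ⟨a, rfl⟩ := I.proj_surjective a
    rw [← map_zero I.proj, ← proj_mul, zero_mul]
  mul_zero a := by
    obtain ⟨a, rfl⟩ := I.proj_surjective a
    rw [← map_zero I.proj, ← proj_mul, mul_zero]

instance [IsScalarTower 𝔽 P P] : IsScalarTower 𝔽 I.Quot I.Quot where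
  smul_assoc r a b := by
    obtain ⟨a, rfl⟩ := I.proj_surjective a
    obtain ⟨b, rfl⟩ := I.proj_surjective b
    simp only [smul_eq_mul]
    rw [← map_smul, ← proj_mul, ← proj_mul, ← map_smul, smul_mul_assoc]

instance [SMulCommClass 𝔽 P P] : SMulCommClass 𝔽 I.Quot I.Quot where
  smul_comm r a b := by
    obtain ⟨a, rfl⟩ := I.proj_surjective a
    obtain ⟨b, rfl⟩ := I.proj_surjective b
    simp only [smul_eq_mul]
    rw [← map_smul, ← proj_mul, ← proj_mul, ← map_smul, mul_smul_comm]

end AlgIdeal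

variable (𝔽) in
/-- The two-sided ideal generated by a set. -/
def idealSpan (s : Set P) : AlgIdeal 𝔽 P where
  carrier := {x | ∀ I : AlgIdeal 𝔽 P, s ⊆ I.carrier → x ∈ I.carrier}
  add_mem' hx hy I hI := I.add_mem' (hx I hI) (hy I hI)
  zero_mem' I _ := I.zero_mem'
  smul_mem' r _ hx I hI := I.smul_mem' r (hx I hI)
  mul_mem_left' a _ hx I hI := I.mul_mem_left' a (hx I hI)
  mul_mem_right' a hx I hI := I.mul_mem_right' a (hx I hI)

/-! ### Powers and annihilator -/

/-- The value in `P` of a nonassociative monomial in elements of `P`. -/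
def monomialValue (w : FreeMagma P) : P := FreeMagma.lift id w

theorem exists_monomial_of_succ (w : FreeMagma P) :
    2 ≤ w.length → ∃ w' : FreeMagma P,
      w'.length + 1 = w.length ∧ monomialValue w' = monomialValue w := by
  induction w using FreeMagma.rec with
  | of x => intro h; simp [FreeMagma.length] at h
  | mul a b iha ihb =>
    intro _
    have pa := a.length_pos
    have pb := b.length_pos
    by_cases ha : 2 ≤ a.length
    · obtain ⟨a', h1, h2⟩ := iha ha
      refine ⟨a' * b, ?_, ?_⟩
      · change a'.length + b.length + 1 = a.length + b.length
        omega
      · change monomialValue a' * monomialValue b = monomialValue a * monomialValue b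
        rw [h2]
    · by_cases hb : 2 ≤ b.length
      · obtain ⟨b', h1, h2⟩ := ihb hb
        refine ⟨a * b', ?_, ?_⟩
        · change a.length + b'.length + 1 = a.length + b.length
          omega
        · change monomialValue a * monomialValue b' = monomialValue a * monomialValue b
          rw [h2]
      · refine ⟨FreeMagma.of (monomialValue a * monomialValue b), ?_, rfl⟩
        change 1 + 1 = a.length + b.length
        omega

/-- The values in `P` of all nonassociative monomials of degree `k`. -/
def monomialValues (P : Type v) [NonUnitalNonAssocRing P] (k : ℕ) : Set P :=
  {y | ∃ w : FreeMagma P, w.length = k ∧ monomialValue w = y}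

theorem mul_mem_monomialValues_left {k : ℕ} (a : P) {y : P} (hy : y ∈ monomialValues P k) :
    a * y ∈ monomialValues P k := by
  obtain ⟨w, hw, rfl⟩ := hy
  have pw := w.length_pos
  have hl : (FreeMagma.of a * w).length = 1 + w.length := rfl
  obtain ⟨w', h1, h2⟩ := exists_monomial_of_succ (FreeMagma.of a * w) (by omega)
  exact ⟨w', by omega, h2⟩

theorem mul_mem_monomialValues_right {k : ℕ} (a : P) {y : P} (hy : y ∈ monomialValues P k) :
    y * a ∈ monomialValues P k := by
  obtain ⟨w, hw, rfl⟩ := hy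
  have pw := w.length_pos
  have hl : (w * FreeMagma.of a).length = w.length + 1 := rfl
  obtain ⟨w', h1, h2⟩ := exists_monomial_of_succ (w * FreeMagma.of a) (by omega)
  exact ⟨w', by omega, h2⟩

variable (𝔽 P) in
/-- The power `P^k`: the linear span of the values of all monomials of degree `k` (for `k ≥ 1`),
as an ideal of `P`. -/
def power [IsScalarTower 𝔽 P P] [SMulCommClass 𝔽 P P] (k : ℕ) : AlgIdeal 𝔽 P where
  toSubmodule := Submodule.span 𝔽 (monomialValues P k)
  mul_mem_left' a x hx := by
    change x ∈ Submodule.span 𝔽 (monomialValues P k) at hx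
    change a * x ∈ Submodule.span 𝔽 (monomialValues P k)
    induction hx using Submodule.span_induction with
    | mem y hy => exact Submodule.subset_span (mul_mem_monomialValues_left a hy)
    | zero => rw [mul_zero]; exact Submodule.zero_mem _
    | add y z _ _ h1 h2 => rw [mul_add]; exact Submodule.add_mem _ h1 h2
    | smul r y _ h => rw [mul_smul_comm]; exact Submodule.smul_mem _ r h
  mul_mem_right' {x} a hx := by
    change x ∈ Submodule.span 𝔽 (monomialValues P k) at hx
    change x * a ∈ Submodule.span 𝔽 (monomialValues P k)
    induction hx using Submodule.span_induction with
    | mem y hy => exact Submodule.subset_span (mul_mem_monomialValues_right a hy)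
    | zero => rw [zero_mul]; exact Submodule.zero_mem _
    | add y z _ _ h1 h2 => rw [add_mul]; exact Submodule.add_mem _ h1 h2
    | smul r y _ h => rw [smul_mul_assoc]; exact Submodule.smul_mem _ r h

variable (𝔽 P) in
/-- The annihilator `I(P) = {x | a x = x a = 0 for all a}`. -/
def annihilator [IsScalarTower 𝔽 P P] [SMulCommClass 𝔽 P P] : AlgIdeal 𝔽 P where
  carrier := {x | ∀ a : P, a * x = 0 ∧ x * a = 0}
  add_mem' hx hy a := by
    rw [mul_add, add_mul, (hx a).1, (hx a).2, (hy a).1, (hy a).2]; simp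
  zero_mem' a := by simp
  smul_mem' r x hx a := by
    rw [mul_smul_comm, smul_mul_assoc, (hx a).1, (hx a).2]; simp
  mul_mem_left' b x hx a := by
    rw [(hx b).1]; simp
  mul_mem_right' b hx a := by
    rw [(hx b).2]; simp

end Unbundled

/-- `P` and `Q` are isomorphic as algebras over `𝔽`. -/
def Isomorphic (𝔽 : Type u) [Field 𝔽] (P Q : Type v)
    [NonUnitalNonAssocRing P] [Module 𝔽 P] [NonUnitalNonAssocRing Q] [Module 𝔽 Q] : Prop :=
  ∃ f : P →ₙₐ[𝔽] Q, Function.Bijective f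

/-- `P` is `n`-generated: it is generated, as an algebra, by some `n` elements
(repetitions allowed). -/
def NGenerated (𝔽 : Type u) [Field 𝔽] (P : Type v) [NonUnitalNonAssocRing P] [Module 𝔽 P]
    [IsScalarTower 𝔽 P P] [SMulCommClass 𝔽 P P] (n : ℕ) : Prop :=
  ∃ x : Fin n → P, NonUnitalAlgebra.adjoin 𝔽 (Set.range x) = ⊤

section Classes

variable {𝔽 : Type u} [Field 𝔽]

/-! ### Primitive classes and relatively free algebras -/

/-- `v = 0` is an identity in `P`, for a nonassociative polynomial `v(x₀, x₁, …)`. -/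
def IsIdentity (v : FreeNonUnitalNonAssocAlgebra 𝔽 ℕ) (P : Type u) [NonUnitalNonAssocRing P]
    [Module 𝔽 P] [IsScalarTower 𝔽 P P] [SMulCommClass 𝔽 P P] : Prop :=
  ∀ a : ℕ → P, FreeNonUnitalNonAssocAlgebra.lift 𝔽 a v = 0

/-- A class of algebras is primitive if it consists of all algebras satisfying some nonempty set
of identities. -/
def IsPrimitive (C : Set (NAlg 𝔽)) : Prop :=
  ∃ V : Set (FreeNonUnitalNonAssocAlgebra 𝔽 ℕ), V.Nonempty ∧
    C = {P | ∀ v ∈ V, IsIdentity v P.carrier}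

/-- The verbal ideal of `P` that corresponds to the class `C`: the ideal generated by all values
in `P` of the polynomials `v` such that `v = 0` is an identity in `C`. -/
def verbalIdeal (C : Set (NAlg 𝔽)) (P : Type u) [NonUnitalNonAssocRing P]
    [Module 𝔽 P] [IsScalarTower 𝔽 P P] [SMulCommClass 𝔽 P P] : AlgIdeal 𝔽 P :=
  idealSpan 𝔽 {y | ∃ v : FreeNonUnitalNonAssocAlgebra 𝔽 ℕ,
    (∀ Q ∈ C, IsIdentity v Q.carrier) ∧
      ∃ a : ℕ → P, FreeNonUnitalNonAssocAlgebra.lift 𝔽 a v = y}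

/-- The free algebra `F_n(C)` of rank `n` of a primitive class `C`: the quotient of the absolutely
free algebra with `n` free generators by its verbal ideal. -/
abbrev RelFree (C : Set (NAlg 𝔽)) (n : ℕ) : Type u :=
  (verbalIdeal C (FreeNonUnitalNonAssocAlgebra 𝔽 (Fin n))).Quot

variable (𝔽) in
/-- The class `𝔑_k` of all nilpotent algebras `P` with `P^(k+1) = 0`. -/
def nilClass (k : ℕ) : Set (NAlg 𝔽) :=
  {P | (power 𝔽 P.carrier (k + 1)).toSubmodule = ⊥}

/-- The class `C` is `c`-step nilpotent: `P^(c+1) = 0` for all `P` in `C`, and `P^c ≠ 0` for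
some `P` in `C`. -/
def IsStepNilpotent (C : Set (NAlg 𝔽)) (c : ℕ) : Prop :=
  C ⊆ nilClass 𝔽 c ∧ ∃ P ∈ C, (power 𝔽 P.carrier c).toSubmodule ≠ ⊥

/-- The `c`-step nilpotent class `C` is central: `I(F_n(C)) = F_n(C)^c` for all ranks `n ≥ 2`. -/
def IsCentral (C : Set (NAlg 𝔽)) (c : ℕ) : Prop :=
  ∀ n : ℕ, 2 ≤ n → annihilator 𝔽 (RelFree C n) = power 𝔽 (RelFree C n) c

/-! ### Isomorphism classes -/

theorem Isomorphic.equivalence :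
    Equivalence (fun P Q : NAlg 𝔽 => Isomorphic 𝔽 P.carrier Q.carrier) where
  refl P := ⟨NonUnitalAlgHom.id 𝔽 P.carrier, Function.bijective_id⟩
  symm := by
    rintro P Q ⟨f, hf⟩
    let e := Equiv.ofBijective f hf
    exact ⟨f.inverse e.symm e.left_inv e.right_inv, e.symm.bijective⟩
  trans := by
    rintro P Q R ⟨f, hf⟩ ⟨g, hg⟩
    exact ⟨g.comp f, hg.comp hf⟩

/-- The isomorphism relation on algebras over `𝔽`. -/
instance isoSetoid : Setoid (NAlg 𝔽) :=
  ⟨fun P Q => Isomorphic 𝔽 P.carrier Q.carrier, Isomorphic.equivalence⟩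

/-- The set of the isomorphism classes of the algebras in `A`. -/
def isoClasses (A : Set (NAlg 𝔽)) : Set (Quotient (isoSetoid (𝔽 := 𝔽))) :=
  (fun P => Quotient.mk isoSetoid P) '' A

/-- The `n`-generated algebras in `C`. -/
def nGeneratedIn (C : Set (NAlg 𝔽)) (n : ℕ) : Set (NAlg 𝔽) :=
  {P | P ∈ C ∧ NGenerated 𝔽 P.carrier n}

/-- The algebras `P` such that `P / P^c` is a free algebra of rank `n` in the class `D`. -/
def quotientFree (D : Set (NAlg 𝔽)) (c n : ℕ) : Set (NAlg 𝔽) :=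
  {P | Isomorphic 𝔽 (power 𝔽 P.carrier c).Quot (RelFree D n)}

end Classes

end NilpotentGeneric

end

/-!
# Most nilpotent algebras of a central class have a relatively free quotient

Let `F = RelFree C n`, let `A = F ^ c`, which is the annihilator of `F`, and let `q = |𝔽|`. Every
`n`-generated algebra of the class is a quotient `F / J` by an ideal `J`, and its class belongs to
`T n` as soon as `J ⊆ A` (`isoClasses_nGeneratedIn`, `quotClass_mem_of_le`). Hence it suffices to
show that the ideals not contained in `A` are much fewer than the isomorphism classes that come
from the subspaces of `A`; all of the latter are ideals. Put `D = dim A` and `d = dim F / A`.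

* An isomorphism `F / K ≅ F / L` with `K, L ⊆ A` lifts to an endomorphism of `F`, whose restriction
  to `A` depends only on the images of the generators modulo `A`. So each isomorphism class
  comes from at most `q ^ (d n)` subspaces of `A` (`card_submodule_le_card_mul_pow`).
* If an ideal `J` has an image of dimension `j` in `F / A`, then `dim (J ∩ A)` is at least a
  constant multiple of `j n` (`IsRelFree.finrank_ideal_le`). For `J = F` this gives
  `d n = O(D)`.
* An ideal `J` with `dim J / (J ∩ A) = j` is determined by `j` elements of `F` and by the subspace
  `J ∩ A`, which contains the intersection of `A` with the ideal generated by these elements, a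
  subspace of dimension at least a large multiple of `j`. Prescribing a subspace of dimension `b`
  reduces the number of subspaces of `A` by a factor exponential in `b D`
  (`card_submodule_ge_mul_pow_le`), which outweighs the `q ^ O(j D)` choices of the elements
  (`card_not_le_mul_pow_le`).

The second point is where centrality enters. Over a finite field the relatively free algebra need
not be graded by degree, but it is graded by sets of variables: `IsRelFree.component S` extracts
the part in which exactly the variables of `S` occur. The terms of the series
`IsRelFree.annSeries` are obtained by iterating "all products of the components lie in the
previous term"; by centrality the first term is `A`, and the `c`-th is `F`. Order the sets of
variables colexicographically, and consider the leading supports of the elements of an ideal `J` in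
each term modulo the previous one (`IsRelFree.leading`). If `S` is such a leading support, then a
product with a monomial in variables outside `S` has a leading support `R ⊇ S` one term below, and
`R` can be made to contain any prescribed variable
(`IsRelFree.exists_leading_of_leading_succ`). Since supports have at most `c` elements, double
counting shows that the number of leading supports grows by a factor of order `n` with each step
down. As each component has bounded dimension, these numbers control the dimensions.
-/

set_option linter.unusedSectionVars false

namespace NilpotentGeneric

/-! ### Monomials and their variables -/

section Monomials

variable {X Y : Type*}

theorem length_mul (a b : FreeMagma X) : (a * b).length = a.length + b.length := rfl

theorem length_map (f : X → Y) (w : FreeMagma X) : (FreeMagma.map f w).length = w.length := by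
  induction w with
  | ih1 x => rfl
  | ih2 a b ha hb => rw [map_mul, length_mul, length_mul, ha, hb]

theorem lift_map {M : Type*} [Mul M] (x : Y → M) (f : X → Y) (w : FreeMagma X) :
    FreeMagma.lift x (FreeMagma.map f w) = FreeMagma.lift (x ∘ f) w := by
  induction w with
  | ih1 x => rfl
  | ih2 a b ha hb => rw [map_mul, map_mul, map_mul, ha, hb]

theorem map_lift {M N F : Type*} [Mul M] [Mul N] [FunLike F M N] [MulHomClass F M N] (φ : F)
    (x : X → M) (w : FreeMagma X) :
    φ (FreeMagma.lift x w) = FreeMagma.lift (fun i => φ (x i)) w := by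
  induction w with
  | ih1 x => rfl
  | ih2 a b ha hb => rw [map_mul, map_mul, map_mul, ha, hb]

theorem map_map {Z : Type*} (g : Y → Z) (f : X → Y) (w : FreeMagma X) :
    FreeMagma.map g (FreeMagma.map f w) = FreeMagma.map (fun i => g (f i)) w :=
  lift_map _ _ _

theorem map_id (w : FreeMagma X) : FreeMagma.map id w = w := by
  induction w with
  | ih1 x => rfl
  | ih2 a b ha hb => rw [map_mul, ha, hb]

theorem finite_length_le (X : Type*) [Finite X] (k : ℕ) :
    {w : FreeMagma X | w.length ≤ k}.Finite := by
  induction k with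
  | zero =>
    refine Set.Finite.subset Set.finite_empty fun w hw => ?_
    have := w.length_pos
    simp only [Set.mem_ofPred_eq] at hw
    omega
  | succ k ih =>
    refine ((Set.finite_range (FreeMagma.of : X → FreeMagma X)).union
      (Set.Finite.image2 (· * ·) ih ih)).subset fun w hw => ?_
    induction w with
    | ih1 x => exact Or.inl ⟨x, rfl⟩
    | ih2 a b _ _ =>
      have ha := a.length_pos
      have hb := b.length_pos
      simp only [Set.mem_ofPred_eq, length_mul] at hw
      exact Or.inr ⟨a, by simp only [Set.mem_ofPred_eq]; omega, b,
        by simp only [Set.mem_ofPred_eq]; omega, rfl⟩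

/-- Every monomial in arbitrary letters is obtained by substitution from a monomial in the
variables indexed by `ℕ`. -/
theorem exists_map_eq_of_nat [Nonempty X] (w : FreeMagma X) :
    ∃ (a : ℕ → X) (u : FreeMagma ℕ), FreeMagma.map a u = w := by
  induction w with
  | ih1 x => exact ⟨fun _ => x, FreeMagma.of 0, rfl⟩
  | ih2 p r hp hr =>
    obtain ⟨a, u, rfl⟩ := hp
    obtain ⟨b, v, rfl⟩ := hr
    -- even variables carry the letters of the left factor, odd ones those of the right factor
    refine ⟨fun i => if i % 2 = 0 then a (i / 2) else b (i / 2),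
      FreeMagma.map (fun i => 2 * i) u * FreeMagma.map (fun i => 2 * i + 1) v, ?_⟩
    rw [map_mul, map_map, map_map]
    congr 3
    · funext i
      have h1 : 2 * i % 2 = 0 := by omega
      have h2 : 2 * i / 2 = i := by omega
      rw [if_pos h1, h2]
    · funext i
      have h1 : (2 * i + 1) % 2 ≠ 0 := by omega
      have h2 : (2 * i + 1) / 2 = i := by omega
      rw [if_neg h1, h2]

/-- The set of the variables that occur in a monomial. -/
def vars [DecidableEq X] : FreeMagma X → Finset X
  | FreeMagma.of x => {x}
  | FreeMagma.mul a b => vars a ∪ vars b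

variable [DecidableEq X] [DecidableEq Y]

@[simp] theorem vars_of (x : X) : vars (FreeMagma.of x) = {x} := rfl

@[simp] theorem vars_mul (a b : FreeMagma X) : vars (a * b) = vars a ∪ vars b := rfl

theorem vars_nonempty (w : FreeMagma X) : (vars w).Nonempty := by
  induction w with
  | ih1 x => exact Finset.singleton_nonempty x
  | ih2 a b ha hb => exact ha.mono Finset.subset_union_left

theorem card_vars_le (w : FreeMagma X) : (vars w).card ≤ w.length := by
  induction w with
  | ih1 x => exact le_of_eq (Finset.card_singleton x)
  | ih2 a b ha hb =>
    rw [vars_mul, length_mul]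
    exact (Finset.card_union_le _ _).trans (add_le_add ha hb)

theorem vars_map (f : X → Y) (w : FreeMagma X) :
    vars (FreeMagma.map f w) = (vars w).image f := by
  induction w with
  | ih1 x => simp
  | ih2 a b ha hb => rw [map_mul, vars_mul, vars_mul, ha, hb, Finset.image_union]

theorem lift_congr {M : Type*} [Mul M] {x y : X → M} {w : FreeMagma X}
    (h : ∀ i ∈ vars w, x i = y i) : FreeMagma.lift x w = FreeMagma.lift y w := by
  induction w with
  | ih1 i => exact h i (by simp)
  | ih2 a b ha hb =>
    rw [map_mul, map_mul, ha fun i hi => h i (by simp [hi]), hb fun i hi => h i (by simp [hi])]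

omit [DecidableEq Y] in
theorem map_congr {f g : X → Y} {w : FreeMagma X} (h : ∀ i ∈ vars w, f i = g i) :
    FreeMagma.map f w = FreeMagma.map g w :=
  lift_congr fun i hi => congrArg FreeMagma.of (h i hi)

omit [DecidableEq X] in
theorem exists_map_eq_of_vars (f : X → Y) {w : FreeMagma Y}
    (h : ∀ i ∈ vars w, i ∈ Set.range f) : ∃ u, FreeMagma.map f u = w := by
  induction w with
  | ih1 i =>
    obtain ⟨j, rfl⟩ := h i (by simp)
    exact ⟨FreeMagma.of j, rfl⟩
  | ih2 a b ha hb =>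
    obtain ⟨u, rfl⟩ := ha fun i hi => h i (by simp [hi])
    obtain ⟨v, rfl⟩ := hb fun i hi => h i (by simp [hi])
    exact ⟨u * v, map_mul _ _ _⟩

/-- A monomial `w` can be rewritten in variables outside `S`, one of them prescribed, in such a way
that a substitution of variables which prolongs a given one from `S` leads back to `w`. -/
theorem exists_fresh_monomial [Fintype X] (S : Finset X) (w : FreeMagma X)
    (hcard : S.card + (vars w).card ≤ Fintype.card X) (θ : X → X) {i : X} (hi : i ∉ S) :
    ∃ (u : FreeMagma X) (η : X → X), Disjoint S (vars u) ∧ i ∈ vars u ∧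
      (∀ j ∈ S, η j = θ j) ∧ FreeMagma.map η u = w := by
  have h1 : ({i} : Finset X) ⊆ Sᶜ := by simpa using hi
  obtain ⟨T, hiT, hTS, hT⟩ := Finset.exists_subsuperset_card_eq (n := (vars w).card) h1
    (by simpa using (vars_nonempty w).card_pos) (by rw [Finset.card_compl]; omega)
  have e : vars w ≃ T := Fintype.equivOfCardEq (by simpa using hT.symm)
  have hdisj : Disjoint S T := by
    rw [Finset.disjoint_left]
    intro j hj hjT
    exact (Finset.mem_compl.1 (hTS hjT)) hj
  refine ⟨FreeMagma.map (fun j => if hj : j ∈ vars w then (e ⟨j, hj⟩ : X) else j) w,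
    fun j => if hj : j ∈ T then (e.symm ⟨j, hj⟩ : X) else θ j, ?_, ?_, ?_, ?_⟩
  · rw [vars_map, Finset.disjoint_left]
    intro j hj hj'
    obtain ⟨k, hk, rfl⟩ := Finset.mem_image.1 hj'
    rw [dif_pos hk] at hj
    exact (Finset.disjoint_left.1 hdisj hj) (e ⟨k, hk⟩).2
  · rw [vars_map, Finset.mem_image]
    obtain ⟨k, hk⟩ := e.surjective ⟨i, hiT (Finset.mem_singleton_self i)⟩
    exact ⟨k, k.2, (dif_pos k.2).trans (congrArg Subtype.val hk)⟩
  · intro j hj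
    exact dif_neg (Finset.disjoint_left.1 hdisj hj)
  · rw [map_map]
    conv_rhs => rw [← map_id w]
    refine map_congr fun j hj => ?_
    rw [dif_pos hj, dif_pos (e ⟨j, hj⟩).2]
    simp

end Monomials
/-! ### Powers, quotients and homomorphisms -/

section Algebra

variable {𝔽 : Type u} [Field 𝔽] {X : Type*}
variable {P : Type v} [NonUnitalNonAssocRing P] [Module 𝔽 P] [IsScalarTower 𝔽 P P]
  [SMulCommClass 𝔽 P P]
variable {Q : Type v} [NonUnitalNonAssocRing Q] [Module 𝔽 Q] [IsScalarTower 𝔽 Q Q]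
  [SMulCommClass 𝔽 Q Q]

theorem AlgIdeal.mul_mem_left (I : AlgIdeal 𝔽 P) (a : P) {x : P} (hx : x ∈ I.toSubmodule) :
    a * x ∈ I.toSubmodule := I.mul_mem_left' a hx

theorem AlgIdeal.mul_mem_right (I : AlgIdeal 𝔽 P) {x : P} (a : P) (hx : x ∈ I.toSubmodule) :
    x * a ∈ I.toSubmodule := I.mul_mem_right' a hx

theorem AlgIdeal.toSubmodule_injective :
    Function.Injective (AlgIdeal.toSubmodule : AlgIdeal 𝔽 P → Submodule 𝔽 P) := by
  rintro ⟨I, _, _⟩ ⟨J, _, _⟩ h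
  cases h
  rfl

theorem subset_idealSpan (s : Set P) : s ⊆ (idealSpan 𝔽 s).toSubmodule :=
  fun _ hx _ hI => hI hx

theorem idealSpan_le {s : Set P} {I : AlgIdeal 𝔽 P} (h : s ⊆ I.toSubmodule) :
    (idealSpan 𝔽 s).toSubmodule ≤ I.toSubmodule := fun _ hx => hx I h

/-- The preimage of an ideal under a homomorphism. -/
def AlgIdeal.comap (φ : P →ₙₐ[𝔽] Q) (I : AlgIdeal 𝔽 Q) : AlgIdeal 𝔽 P where
  toSubmodule := I.toSubmodule.comap (φ : P →ₗ[𝔽] Q)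
  mul_mem_left' a x hx := by
    change φ (a * x) ∈ I.toSubmodule
    rw [map_mul]
    exact I.mul_mem_left _ hx
  mul_mem_right' {x} a hx := by
    change φ (x * a) ∈ I.toSubmodule
    rw [map_mul]
    exact I.mul_mem_right _ hx

variable (𝔽 P) in
/-- The zero ideal. -/
def AlgIdeal.zero : AlgIdeal 𝔽 P where
  toSubmodule := ⊥
  mul_mem_left' a x hx := by
    change a * x ∈ (⊥ : Submodule 𝔽 P)
    rw [show x = 0 from hx, mul_zero]
    exact Submodule.zero_mem _
  mul_mem_right' {x} a hx := by
    change x * a ∈ (⊥ : Submodule 𝔽 P)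
    rw [show x = 0 from hx, zero_mul]
    exact Submodule.zero_mem _

/-- The kernel of a homomorphism. -/
def kernel (φ : P →ₙₐ[𝔽] Q) : AlgIdeal 𝔽 P := (AlgIdeal.zero 𝔽 Q).comap φ

theorem mem_kernel {φ : P →ₙₐ[𝔽] Q} {x : P} : x ∈ (kernel φ).toSubmodule ↔ φ x = 0 := Iff.rfl

/-- The canonical projection `P → P / I` as a homomorphism of algebras. -/
def AlgIdeal.projHom (I : AlgIdeal 𝔽 P) : P →ₙₐ[𝔽] I.Quot where
  toFun := I.proj
  map_smul' r x := map_smul I.proj r x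
  map_zero' := map_zero I.proj
  map_add' := map_add I.proj
  map_mul' := I.proj_mul

theorem AlgIdeal.projHom_surjective (I : AlgIdeal 𝔽 P) : Function.Surjective I.projHom :=
  I.proj_surjective

theorem AlgIdeal.projHom_eq_zero {I : AlgIdeal 𝔽 P} {x : P} :
    I.projHom x = 0 ↔ x ∈ I.toSubmodule := by
  rw [← map_zero I.projHom]
  exact I.proj_eq_proj.trans (by rw [sub_zero])

theorem AlgIdeal.projHom_eq {I : AlgIdeal 𝔽 P} {x y : P} :
    I.projHom x = I.projHom y ↔ x - y ∈ I.toSubmodule := I.proj_eq_proj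

/-- A homomorphism factors through any surjective homomorphism with smaller kernel. -/
theorem exists_factor {R : Type v} [NonUnitalNonAssocRing R] [Module 𝔽 R] (π : P →ₙₐ[𝔽] Q)
    (hπ : Function.Surjective π) (φ : P →ₙₐ[𝔽] R) (h : ∀ x, π x = 0 → φ x = 0) :
    ∃ ψ : Q →ₙₐ[𝔽] R, ∀ x, ψ (π x) = φ x := by
  have key : ∀ x y, π x = π y → φ x = φ y := by
    intro x y hxy
    rw [← sub_eq_zero, ← map_sub]
    exact h _ (by rw [map_sub, hxy, sub_self])
  have hg : ∀ x, φ (Function.surjInv hπ (π x)) = φ x := fun x =>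
    key _ _ (Function.surjInv_eq hπ (π x))
  refine ⟨{ toFun := fun q => φ (Function.surjInv hπ q)
            map_smul' := ?_
            map_zero' := ?_
            map_add' := ?_
            map_mul' := ?_ }, hg⟩
  · intro r q
    obtain ⟨x, rfl⟩ := hπ q
    change φ (Function.surjInv hπ (r • π x)) = r • φ (Function.surjInv hπ (π x))
    rw [← map_smul π, hg, hg, map_smul φ]
  · rw [← map_zero π, hg, map_zero]
  · intro q q'
    obtain ⟨x, rfl⟩ := hπ q
    obtain ⟨y, rfl⟩ := hπ q'
    rw [← map_add, hg, hg, hg, map_add]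
  · intro q q'
    obtain ⟨x, rfl⟩ := hπ q
    obtain ⟨y, rfl⟩ := hπ q'
    rw [← map_mul, hg, hg, hg, map_mul]

theorem isomorphic_of_surjective {R : Type v} [NonUnitalNonAssocRing R] [Module 𝔽 R]
    (π : P →ₙₐ[𝔽] Q) (hπ : Function.Surjective π) (φ : P →ₙₐ[𝔽] R)
    (hφ : Function.Surjective φ) (h : ∀ x, π x = 0 ↔ φ x = 0) : Isomorphic 𝔽 Q R := by
  obtain ⟨ψ, hψ⟩ := exists_factor π hπ φ fun x => (h x).1
  refine ⟨ψ, (injective_iff_map_eq_zero ψ).2 fun q hq => ?_, fun r => ?_⟩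
  · obtain ⟨x, rfl⟩ := hπ q
    rw [hψ] at hq
    exact (h x).2 hq
  · obtain ⟨x, rfl⟩ := hφ r
    exact ⟨π x, hψ x⟩

/-! ### Powers in terms of generators -/

theorem mul_mem_of_mem_span {A B : Set P} {M : Submodule 𝔽 P}
    (h : ∀ a ∈ A, ∀ b ∈ B, a * b ∈ M) {y z : P} (hy : y ∈ Submodule.span 𝔽 A)
    (hz : z ∈ Submodule.span 𝔽 B) : y * z ∈ M := by
  induction hy, hz using Submodule.span_induction₂ with
  | mem_mem a b ha hb => exact h a ha b hb
  | zero_left b _ => rw [zero_mul]; exact Submodule.zero_mem _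
  | zero_right b _ => rw [mul_zero]; exact Submodule.zero_mem _
  | add_left a b c _ _ _ h1 h2 => rw [add_mul]; exact Submodule.add_mem _ h1 h2
  | add_right a b c _ _ _ h1 h2 => rw [mul_add]; exact Submodule.add_mem _ h1 h2
  | smul_left r a b _ _ h => rw [smul_mul_assoc]; exact Submodule.smul_mem _ r h
  | smul_right r a b _ _ h => rw [mul_smul_comm]; exact Submodule.smul_mem _ r h

theorem monomialValue_mem_power_of_le {k : ℕ} (hk : 1 ≤ k) (w : FreeMagma P)
    (hw : k ≤ w.length) : monomialValue w ∈ (power 𝔽 P k).toSubmodule := by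
  obtain ⟨m, hm⟩ := Nat.exists_eq_add_of_le hw
  induction m generalizing w with
  | zero => exact Submodule.subset_span ⟨w, by omega, rfl⟩
  | succ m ih =>
    obtain ⟨w', h1, h2⟩ := exists_monomial_of_succ w (by omega)
    rw [← h2]
    exact ih w' (by omega) (by omega)

theorem lift_mem_power {k : ℕ} (hk : 1 ≤ k) (x : X → P) (w : FreeMagma X) (hw : k ≤ w.length) :
    FreeMagma.lift x w ∈ (power 𝔽 P k).toSubmodule := by
  have h := monomialValue_mem_power_of_le (𝔽 := 𝔽) hk (FreeMagma.map x w) (by rwa [length_map])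
  rwa [monomialValue, lift_map] at h

theorem mem_span_of_adjoin {x : X → P} (hx : NonUnitalAlgebra.adjoin 𝔽 (Set.range x) = ⊤) :
    Submodule.span 𝔽 (Set.range (FreeMagma.lift x)) = ⊤ := by
  rw [eq_top_iff]
  intro y _
  have hy : y ∈ NonUnitalAlgebra.adjoin 𝔽 (Set.range x) := by rw [hx]; trivial
  induction hy using NonUnitalAlgebra.adjoin_induction with
  | mem y hy =>
    obtain ⟨i, rfl⟩ := hy
    exact Submodule.subset_span ⟨FreeMagma.of i, rfl⟩
  | add y z _ _ h1 h2 => exact Submodule.add_mem _ (h1 trivial) (h2 trivial)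
  | zero => exact Submodule.zero_mem _
  | smul r y _ h => exact Submodule.smul_mem _ r (h trivial)
  | mul y z _ _ h1 h2 =>
    refine mul_mem_of_mem_span ?_ (h1 trivial) (h2 trivial)
    rintro _ ⟨u, rfl⟩ _ ⟨w, rfl⟩
    exact Submodule.subset_span ⟨u * w, map_mul _ _ _⟩

/-- If the monomials in the elements `x i` span the algebra, then its `k`-th power is spanned by
the monomials in the `x i` of degree at least `k`. -/
theorem power_eq_span {x : X → P} (hx : Submodule.span 𝔽 (Set.range (FreeMagma.lift x)) = ⊤)
    {k : ℕ} (hk : 1 ≤ k) : (power 𝔽 P k).toSubmodule =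
      Submodule.span 𝔽 (FreeMagma.lift x '' {w | k ≤ w.length}) := by
  apply le_antisymm
  · have key : ∀ w : FreeMagma P, monomialValue w ∈
        Submodule.span 𝔽 (FreeMagma.lift x '' {u | w.length ≤ u.length}) := by
      intro w
      induction w with
      | ih1 y =>
        have hy : y ∈ Submodule.span 𝔽 (Set.range (FreeMagma.lift x)) := by rw [hx]; trivial
        refine Submodule.span_mono ?_ hy
        rintro _ ⟨u, rfl⟩
        exact ⟨u, u.length_pos, rfl⟩
      | ih2 a b ha hb =>
        refine mul_mem_of_mem_span ?_ ha hb
        rintro _ ⟨u, hu, rfl⟩ _ ⟨w, hw, rfl⟩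
        refine Submodule.subset_span ⟨u * w, ?_, map_mul _ _ _⟩
        have hu' : a.length ≤ u.length := hu
        have hw' : b.length ≤ w.length := hw
        exact add_le_add hu' hw'
    refine Submodule.span_le.2 ?_
    rintro _ ⟨w, rfl, rfl⟩
    exact key w
  · refine Submodule.span_le.2 ?_
    rintro _ ⟨w, hw, rfl⟩
    exact lift_mem_power hk x w hw

theorem mul_mem_power_succ {k : ℕ} {y : P} (a : P)
    (hy : y ∈ (power 𝔽 P k).toSubmodule) :
    y * a ∈ (power 𝔽 P (k + 1)).toSubmodule ∧ a * y ∈ (power 𝔽 P (k + 1)).toSubmodule := by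
  have ha : a ∈ Submodule.span 𝔽 {a} := Submodule.mem_span_singleton_self a
  constructor
  · refine mul_mem_of_mem_span (A := monomialValues P k) ?_ hy ha
    rintro _ ⟨w, hw, rfl⟩ _ rfl
    exact Submodule.subset_span ⟨w * FreeMagma.of _, by rw [length_mul, hw]; rfl, rfl⟩
  · refine mul_mem_of_mem_span (B := monomialValues P k) ?_ ha hy
    rintro _ rfl _ ⟨w, hw, rfl⟩
    exact Submodule.subset_span
      ⟨FreeMagma.of _ * w, by rw [length_mul, hw, add_comm]; rfl, rfl⟩

theorem power_one : (power 𝔽 P 1).toSubmodule = ⊤ :=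
  eq_top_iff.2 fun y _ => Submodule.subset_span ⟨FreeMagma.of y, rfl, rfl⟩

theorem exists_mem_power_of_surjective (φ : P →ₙₐ[𝔽] Q) (hφ : Function.Surjective φ) {k : ℕ}
    {z : Q} (hz : z ∈ (power 𝔽 Q k).toSubmodule) :
    ∃ y ∈ (power 𝔽 P k).toSubmodule, φ y = z := by
  have h : (power 𝔽 Q k).toSubmodule ≤
      (power 𝔽 P k).toSubmodule.map (φ : P →ₗ[𝔽] Q) := by
    refine Submodule.span_le.2 ?_
    rintro _ ⟨w, hw, rfl⟩
    refine ⟨monomialValue (FreeMagma.map (Function.surjInv hφ) w),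
      Submodule.subset_span ⟨_, by rw [length_map, hw], rfl⟩, ?_⟩
    change φ (FreeMagma.lift id _) = _
    rw [lift_map, map_lift]
    change FreeMagma.lift (fun i => φ (Function.surjInv hφ i)) w = _
    simp only [Function.surjInv_eq]
    rfl
  exact h hz

/-- In an algebra with `P^(k+1) = 0` the long monomials vanish. -/
theorem lift_eq_zero {k : ℕ} (h : (power 𝔽 P (k + 1)).toSubmodule = ⊥) (x : X → P)
    {w : FreeMagma X} (hw : k < w.length) : FreeMagma.lift x w = 0 := by
  have := lift_mem_power (𝔽 := 𝔽) (k := k + 1) (by omega) x w hw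
  rwa [h, Submodule.mem_bot] at this

theorem mem_annihilator {x : P} :
    x ∈ (annihilator 𝔽 P).toSubmodule ↔ ∀ a : P, a * x = 0 ∧ x * a = 0 := Iff.rfl

theorem hom_ext_of_span {x : X → P}
    (hx : Submodule.span 𝔽 (Set.range (FreeMagma.lift x)) = ⊤) {M : Type*} [AddCommGroup M]
    [Module 𝔽 M] {f g : P →ₗ[𝔽] M} (h : ∀ w, f (FreeMagma.lift x w) = g (FreeMagma.lift x w)) :
    f = g :=
  LinearMap.ext_on_range (v := FreeMagma.lift x) hx h

end Algebra
/-! ### Support components of a relatively free algebra -/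

section RelativelyFree

variable {𝔽 : Type u} [Field 𝔽]
variable {P : Type v} [NonUnitalNonAssocRing P] [Module 𝔽 P] [IsScalarTower 𝔽 P P]
  [SMulCommClass 𝔽 P P] {n : ℕ}

variable (𝔽) in
/-- `P` is relatively free on the family `x`: the monomials in the `x i` span `P`, and every map of
`x` into `P` extends to an endomorphism of `P`. -/
structure IsRelFree (x : Fin n → P) : Prop where
  span_eq_top : Submodule.span 𝔽 (Set.range (FreeMagma.lift x)) = ⊤
  exists_hom : ∀ f : Fin n → P, ∃ φ : P →ₙₐ[𝔽] P, ∀ i, φ (x i) = f i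

variable (𝔽) in
/-- The product as a bilinear map; for `b = true` the factors are interchanged. -/
noncomputable def sideMul : Bool → P →ₗ[𝔽] P →ₗ[𝔽] P
  | false => LinearMap.mul 𝔽 P
  | true => (LinearMap.mul 𝔽 P).flip

theorem map_sideMul (φ : P →ₙₐ[𝔽] P) (b : Bool) (y a : P) :
    φ (sideMul 𝔽 b y a) = sideMul 𝔽 b (φ y) (φ a) := by
  cases b <;> exact map_mul φ _ _

theorem exists_sideMul_lift (x : Fin n → P) (b : Bool) (w u : FreeMagma (Fin n)) :
    ∃ v, vars v = vars w ∪ vars u ∧ v.length = w.length + u.length ∧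
      sideMul 𝔽 b (FreeMagma.lift x w) (FreeMagma.lift x u) = FreeMagma.lift x v := by
  cases b
  · exact ⟨w * u, rfl, rfl, rfl⟩
  · exact ⟨u * w, Finset.union_comm _ _, add_comm _ _, rfl⟩

theorem AlgIdeal.sideMul_mem (J : AlgIdeal 𝔽 P) {y : P} (hy : y ∈ J.toSubmodule) (b : Bool)
    (a : P) : sideMul 𝔽 b y a ∈ J.toSubmodule := by
  cases b
  · exact J.mul_mem_right a hy
  · exact J.mul_mem_left a hy

theorem sideMul_mem_power_succ {k : ℕ} {y : P} (hy : y ∈ (power 𝔽 P k).toSubmodule) (b : Bool)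
    (a : P) : sideMul 𝔽 b y a ∈ (power 𝔽 P (k + 1)).toSubmodule := by
  cases b
  · exact (mul_mem_power_succ a hy).1
  · exact (mul_mem_power_succ a hy).2

theorem mem_annihilator_iff_sideMul {y : P} :
    y ∈ (annihilator 𝔽 P).toSubmodule ↔ ∀ b a, sideMul 𝔽 b y a = 0 := by
  refine mem_annihilator.trans ⟨fun h b a => ?_, fun h a => ⟨h true a, h false a⟩⟩
  cases b
  · exact (h a).2
  · exact (h a).1

namespace IsRelFree

variable {x : Fin n → P} (hx : IsRelFree 𝔽 x)

/-- The endomorphism that substitutes the generator `x (θ i)` for the generator `x i`. -/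
noncomputable def subst (θ : Fin n → Fin n) : P →ₙₐ[𝔽] P :=
  (hx.exists_hom fun i => x (θ i)).choose

include hx

theorem subst_lift (θ : Fin n → Fin n) (w : FreeMagma (Fin n)) :
    hx.subst θ (FreeMagma.lift x w) = FreeMagma.lift x (FreeMagma.map θ w) := by
  rw [map_lift, lift_map]
  exact lift_congr fun i _ => (hx.exists_hom fun i => x (θ i)).choose_spec i

@[elab_as_elim]
theorem induction_on {p : P → Prop} (y : P) (hp : ∀ w, p (FreeMagma.lift x w))
    (h0 : p 0) (hadd : ∀ y z, p y → p z → p (y + z)) (hsmul : ∀ (r : 𝔽) y, p y → p (r • y)) :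
    p y := by
  have hy : y ∈ Submodule.span 𝔽 (Set.range (FreeMagma.lift x)) := by
    rw [hx.span_eq_top]; trivial
  induction hy using Submodule.span_induction with
  | mem y hy => obtain ⟨w, rfl⟩ := hy; exact hp w
  | zero => exact h0
  | add y z _ _ h1 h2 => exact hadd y z h1 h2
  | smul r y _ h => exact hsmul r y h

/-- The components are obtained by inclusion-exclusion from the endomorphisms that annul the
generators outside a given set. -/
theorem exists_component (S : Finset (Fin n)) : ∃ π : P →ₗ[𝔽] P,
    ∀ w, π (FreeMagma.lift x w) = if vars w = S then FreeMagma.lift x w else 0 := by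
  induction S using Finset.strongInduction with
  | H S ih =>
    choose! π hπ using ih
    obtain ⟨e, he⟩ := hx.exists_hom fun i => if i ∈ S then x i else 0
    have hew : ∀ w, e (FreeMagma.lift x w) = if vars w ⊆ S then FreeMagma.lift x w else 0 := by
      intro w
      rw [map_lift]
      induction w with
      | ih1 i => simpa using he i
      | ih2 a b ha hb =>
        rw [map_mul, ha, hb, map_mul, vars_mul]
        by_cases h1 : vars a ⊆ S <;> by_cases h2 : vars b ⊆ S <;>
          simp [h1, h2, Finset.union_subset_iff]
    refine ⟨(e : P →ₗ[𝔽] P) - ∑ R ∈ S.ssubsets, π R, fun w => ?_⟩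
    rw [LinearMap.sub_apply, LinearMap.sum_apply]
    rw [Finset.sum_congr rfl fun R hR => hπ R (Finset.mem_ssubsets.1 hR) w]
    rw [Finset.sum_ite_eq]
    change e (FreeMagma.lift x w) - _ = _
    rw [hew]
    by_cases h1 : vars w = S
    · simp [h1]
    · by_cases h2 : vars w ⊆ S
      · have h3 : vars w ⊂ S := lt_of_le_of_ne h2 h1
        simp [h1, h2, h3]
      · have h3 : ¬ vars w ⊂ S := fun h => h2 h.1
        simp [h1, h2, h3]

omit hx

/-- The component of an element on the set `S` of variables: the part that is a combination of the
monomials in which exactly the variables of `S` occur. -/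
noncomputable def component (S : Finset (Fin n)) : P →ₗ[𝔽] P := (hx.exists_component S).choose

include hx

theorem component_lift (S : Finset (Fin n)) (w : FreeMagma (Fin n)) :
    hx.component S (FreeMagma.lift x w) = if vars w = S then FreeMagma.lift x w else 0 :=
  (hx.exists_component S).choose_spec w

theorem sum_component (y : P) : ∑ S, hx.component S y = y := by
  have h : ∑ S, hx.component S = LinearMap.id := hom_ext_of_span hx.span_eq_top fun w => by
    rw [LinearMap.sum_apply]
    simp [component_lift]
  simpa using congrArg (fun f => f y) h

theorem component_component (R S : Finset (Fin n)) (y : P) :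
    hx.component R (hx.component S y) = if S = R then hx.component S y else 0 := by
  have h : (hx.component R).comp (hx.component S) = if S = R then hx.component S else 0 :=
    hom_ext_of_span hx.span_eq_top fun w => by
      rw [LinearMap.comp_apply, component_lift]
      split_ifs with h1 h2 h2
      · rw [component_lift, component_lift, if_pos (h1.trans h2), if_pos h1]
      · rw [component_lift, if_neg fun h => h2 (h1.symm.trans h)]; rfl
      · rw [map_zero, component_lift, if_neg h1]
      · rw [map_zero]; rfl
  rw [← LinearMap.comp_apply, h]
  split_ifs <;> rfl

theorem component_sideMul (R : Finset (Fin n)) (b : Bool) (y : P) (u : FreeMagma (Fin n)) :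
    hx.component R (sideMul 𝔽 b y (FreeMagma.lift x u)) =
      ∑ S, if S ∪ vars u = R then sideMul 𝔽 b (hx.component S y) (FreeMagma.lift x u)
        else 0 := by
  refine hx.induction_on y (fun w => ?_) (by simp) (fun y z hy hz => ?_) fun r y hy => ?_
  · obtain ⟨v, hv, -, h⟩ := exists_sideMul_lift (𝔽 := 𝔽) x b w u
    rw [h, component_lift, hv, Finset.sum_eq_single (vars w)]
    · rw [component_lift, if_pos rfl, h]
    · intro S _ hS
      rw [component_lift, if_neg (Ne.symm hS), map_zero, LinearMap.zero_apply, ite_self]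
    · intro h; exact absurd (Finset.mem_univ _) h
  · simp only [map_add, LinearMap.add_apply, hy, hz]
    rw [← Finset.sum_add_distrib]
    refine Finset.sum_congr rfl fun S _ => ?_
    split_ifs <;> simp
  · simp only [map_smul, LinearMap.smul_apply, hy]
    rw [Finset.smul_sum]
    refine Finset.sum_congr rfl fun S _ => ?_
    split_ifs <;> simp

theorem component_subst (θ : Fin n → Fin n) (R : Finset (Fin n)) (y : P) :
    hx.component R (hx.subst θ y) =
      ∑ S, if S.image θ = R then hx.subst θ (hx.component S y) else 0 := by
  refine hx.induction_on y (fun w => ?_) (by simp) (fun y z hy hz => ?_) fun r y hy => ?_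
  · rw [subst_lift, component_lift, vars_map, Finset.sum_eq_single (vars w)]
    · rw [component_lift, if_pos rfl, subst_lift]
    · intro S _ hS
      rw [component_lift, if_neg (Ne.symm hS), map_zero, ite_self]
    · intro h; exact absurd (Finset.mem_univ _) h
  · simp only [map_add, hy, hz]
    rw [← Finset.sum_add_distrib]
    refine Finset.sum_congr rfl fun S _ => ?_
    split_ifs <;> simp
  · simp only [map_smul, hy]
    rw [Finset.smul_sum]
    refine Finset.sum_congr rfl fun S _ => ?_
    split_ifs <;> simp

theorem subst_component_congr {θ η : Fin n → Fin n} {S : Finset (Fin n)}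
    (h : ∀ i ∈ S, η i = θ i) (y : P) :
    hx.subst η (hx.component S y) = hx.subst θ (hx.component S y) := by
  refine hx.induction_on y (fun w => ?_) (by simp) (fun y z hy hz => ?_) fun r y hy => ?_
  · rw [component_lift]
    split_ifs with hw
    · rw [subst_lift, subst_lift, map_congr fun i hi => h i (hw ▸ hi)]
    · simp
  · simp only [map_add, hy, hz]
  · simp only [map_smul, hy]

theorem component_mem_power {k : ℕ} (hk : 1 ≤ k) (S : Finset (Fin n)) {y : P}
    (hy : y ∈ (power 𝔽 P k).toSubmodule) : hx.component S y ∈ (power 𝔽 P k).toSubmodule := by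
  rw [power_eq_span hx.span_eq_top hk] at hy ⊢
  refine (Submodule.span_le.2 ?_ :
    _ ≤ (Submodule.span 𝔽 (FreeMagma.lift x '' {w | k ≤ w.length})).comap (hx.component S)) hy
  rintro _ ⟨w, hw, rfl⟩
  change hx.component S _ ∈ Submodule.span 𝔽 (FreeMagma.lift x '' {w | k ≤ w.length})
  rw [component_lift]
  split_ifs
  · exact Submodule.subset_span ⟨w, hw, rfl⟩
  · exact Submodule.zero_mem _

section Nilpotent

variable {c : ℕ} (hnil : (power 𝔽 P (c + 1)).toSubmodule = ⊥)

include hnil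

theorem component_eq_zero {S : Finset (Fin n)} (hS : c < S.card) (y : P) :
    hx.component S y = 0 := by
  refine hx.induction_on y (fun w => ?_) (by simp) (fun y z hy hz => ?_) fun r y hy => ?_
  · rw [component_lift]
    split_ifs with h
    · exact lift_eq_zero hnil x (hS.trans_le (h ▸ card_vars_le w))
    · rfl
  · rw [map_add, hy, hz, add_zero]
  · rw [map_smul, hy, smul_zero]

theorem range_component_le (S : Finset (Fin n)) : LinearMap.range (hx.component S) ≤
    Submodule.span 𝔽 (FreeMagma.lift x '' {w | vars w = S ∧ w.length ≤ c}) := by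
  rintro _ ⟨y, rfl⟩
  refine hx.induction_on y (fun w => ?_) (by simp) (fun y z hy hz => ?_) fun r y hy => ?_
  · rw [component_lift]
    split_ifs with h
    · by_cases hw : w.length ≤ c
      · exact Submodule.subset_span ⟨w, ⟨h, hw⟩, rfl⟩
      · rw [lift_eq_zero hnil x (not_le.1 hw)]
        exact Submodule.zero_mem _
    · exact Submodule.zero_mem _
  · rw [map_add]; exact Submodule.add_mem _ hy hz
  · rw [map_smul]; exact Submodule.smul_mem _ r hy

theorem span_finite : Submodule.span 𝔽 (FreeMagma.lift x '' {w | w.length ≤ c}) = ⊤ := by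
  rw [eq_top_iff]
  intro y _
  refine hx.induction_on y (fun w => ?_) (Submodule.zero_mem _)
    (fun y z hy hz => Submodule.add_mem _ hy hz) fun r y hy => Submodule.smul_mem _ r hy
  by_cases hw : w.length ≤ c
  · exact Submodule.subset_span ⟨w, hw, rfl⟩
  · rw [lift_eq_zero hnil x (not_le.1 hw)]
    exact Submodule.zero_mem _

theorem finiteDimensional : FiniteDimensional 𝔽 P :=
  ⟨⟨((finite_length_le (Fin n) c).image _).toFinset, by
    rw [Set.Finite.coe_toFinset]; exact hx.span_finite hnil⟩⟩

end Nilpotent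

end IsRelFree

/-- The number of the monomials of degree at most `c` in `c` variables. -/
noncomputable def numMonomials (c : ℕ) : ℕ := {w : FreeMagma (Fin c) | w.length ≤ c}.ncard

/-- The dimension of a component is bounded in terms of the nilpotency class, uniformly in the
number of generators. -/
theorem IsRelFree.finrank_range_component_le {x : Fin n → P} (hx : IsRelFree 𝔽 x) {c : ℕ}
    (hnil : (power 𝔽 P (c + 1)).toSubmodule = ⊥) (S : Finset (Fin n)) :
    Module.finrank 𝔽 (LinearMap.range (hx.component S)) ≤ numMonomials c := by
  have := hx.finiteDimensional hnil
  by_cases hS : S.Nonempty ∧ S.card ≤ c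
  · obtain ⟨⟨i, hi⟩, hc⟩ := hS
    have : Nonempty S := ⟨⟨i, hi⟩⟩
    obtain ⟨g, hg⟩ : ∃ g : Fin c → S, Function.Surjective g := by
      obtain ⟨e⟩ := Function.Embedding.nonempty_of_card_le (α := S) (β := Fin c) (by simpa using hc)
      exact ⟨Function.invFun e, Function.invFun_surjective e.injective⟩
    set ι : Fin c → Fin n := fun j => g j
    have hfin : (FreeMagma.lift x '' (FreeMagma.map ι '' {w | w.length ≤ c})).Finite :=
      ((finite_length_le (Fin c) c).image _).image _
    have hle : LinearMap.range (hx.component S) ≤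
        Submodule.span 𝔽 (FreeMagma.lift x '' (FreeMagma.map ι '' {w | w.length ≤ c})) := by
      refine (hx.range_component_le hnil S).trans (Submodule.span_mono (Set.image_mono ?_))
      rintro w ⟨hw, hl⟩
      obtain ⟨u, rfl⟩ := exists_map_eq_of_vars ι (w := w) fun j hj => by
        obtain ⟨k, hk⟩ := hg ⟨j, hw ▸ hj⟩
        exact ⟨k, congrArg Subtype.val hk⟩
      exact ⟨u, by rwa [length_map] at hl, rfl⟩
    refine (Submodule.finrank_mono hle).trans ?_
    have := hfin.fintype
    refine (finrank_span_le_card _).trans ?_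
    rw [← Set.ncard_eq_toFinset_card']
    exact (Set.ncard_image_le ((finite_length_le (Fin c) c).image _)).trans
      (Set.ncard_image_le (finite_length_le (Fin c) c))
  · have h0 : hx.component S = 0 := by
      refine hom_ext_of_span hx.span_eq_top fun w => ?_
      rw [component_lift]
      split_ifs with h
      · refine lift_eq_zero hnil x (not_le.1 fun hw => hS ?_)
        rw [← h]
        exact ⟨vars_nonempty w, (card_vars_le w).trans hw⟩
      · rfl
    rw [h0, LinearMap.range_zero, finrank_bot]
    exact Nat.zero_le _

end RelativelyFree
/-! ### The annihilator series -/

section AnnihilatorSeries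

variable {𝔽 : Type u} [Field 𝔽]
variable {P : Type v} [NonUnitalNonAssocRing P] [Module 𝔽 P] [IsScalarTower 𝔽 P P]
  [SMulCommClass 𝔽 P P] {n : ℕ} {x : Fin n → P}

namespace IsRelFree

variable (hx : IsRelFree 𝔽 x)

/-- A variant of the upper annihilator series that is adapted to the support components: an
element belongs to the next term if all products with one factor a support component of the element
lie in the present term. -/
noncomputable def annSeries : ℕ → Submodule 𝔽 P
  | 0 => ⊥
  | t + 1 =>
    { carrier := {y | ∀ b S a, sideMul 𝔽 b (hx.component S y) a ∈ annSeries t}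
      add_mem' := fun {y z} hy hz b S a => by
        rw [map_add, map_add, LinearMap.add_apply]
        exact Submodule.add_mem _ (hy b S a) (hz b S a)
      zero_mem' := fun b S a => by
        rw [map_zero, map_zero, LinearMap.zero_apply]
        exact Submodule.zero_mem _
      smul_mem' := fun r y hy b S a => by
        rw [map_smul, map_smul, LinearMap.smul_apply]
        exact Submodule.smul_mem _ r (hy b S a) }

theorem mem_annSeries_zero {y : P} : y ∈ hx.annSeries 0 ↔ y = 0 := Submodule.mem_bot 𝔽

theorem sideMul_mem_annSeries {t : ℕ} {y : P} (hy : y ∈ hx.annSeries (t + 1)) (b : Bool) (a : P) :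
    sideMul 𝔽 b y a ∈ hx.annSeries t := by
  rw [← hx.sum_component y, map_sum, LinearMap.sum_apply]
  exact Submodule.sum_mem _ fun S _ => hy b S a

/-- If a component is outside a term of the series, then some product of it with a monomial is
outside the preceding term. -/
theorem exists_sideMul_lift_notMem {t : ℕ} {S : Finset (Fin n)} {y : P}
    (hy : hx.component S y ∉ hx.annSeries (t + 1)) :
    ∃ b w, sideMul 𝔽 b (hx.component S y) (FreeMagma.lift x w) ∉ hx.annSeries t := by
  by_contra! h
  refine hy fun b R a => ?_
  rw [component_component]
  split_ifs
  · refine hx.induction_on a (h b) ?_ (fun a a' h1 h2 => ?_) fun r a h1 => ?_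
    · rw [map_zero]; exact Submodule.zero_mem _
    · rw [map_add]; exact Submodule.add_mem _ h1 h2
    · rw [map_smul]; exact Submodule.smul_mem _ r h1
  · rw [map_zero, LinearMap.zero_apply]; exact Submodule.zero_mem _

section Nilpotent

variable {c : ℕ} (hnil : (power 𝔽 P (c + 1)).toSubmodule = ⊥)

include hnil

theorem power_le_annSeries {t k : ℕ} (hk : 1 ≤ k) (htk : t + k = c + 1) :
    (power 𝔽 P k).toSubmodule ≤ hx.annSeries t := by
  induction t generalizing k with
  | zero =>
    obtain rfl : k = c + 1 := by omega
    rw [hnil]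
    exact bot_le
  | succ t ih =>
    intro y hy b S a
    exact ih (k := k + 1) (by omega) (by omega)
      (sideMul_mem_power_succ (hx.component_mem_power hk S hy) b a)

theorem annSeries_class : hx.annSeries c = ⊤ := by
  rw [eq_top_iff, ← power_one]
  exact hx.power_le_annSeries hnil le_rfl rfl

theorem annSeries_one (hc : 1 ≤ c)
    (hcentral : (annihilator 𝔽 P).toSubmodule = (power 𝔽 P c).toSubmodule) :
    hx.annSeries 1 = (power 𝔽 P c).toSubmodule := by
  apply le_antisymm
  · intro y hy
    rw [← hx.sum_component y]
    refine Submodule.sum_mem _ fun S _ => ?_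
    rw [← hcentral]
    exact mem_annihilator_iff_sideMul.2 fun b a => hx.mem_annSeries_zero.1 (hy b S a)
  · exact hx.power_le_annSeries hnil hc (add_comm _ _)

/-- A product of a component by a monomial is, up to a substitution of variables, the product of
the component by a monomial in fresh variables. -/
theorem exists_fresh_sideMul (hn : 2 * c ≤ n) {S : Finset (Fin n)} {y : P} {b : Bool}
    {w : FreeMagma (Fin n)} (θ : Fin n → Fin n)
    (h0 : sideMul 𝔽 b (hx.subst θ (hx.component S y)) (FreeMagma.lift x w) ≠ 0)
    {i : Fin n} (hi : i ∉ S) :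
    ∃ (u : FreeMagma (Fin n)) (η : Fin n → Fin n), Disjoint S (vars u) ∧ i ∈ vars u ∧
      sideMul 𝔽 b (hx.subst θ (hx.component S y)) (FreeMagma.lift x w) =
        hx.subst η (sideMul 𝔽 b (hx.component S y) (FreeMagma.lift x u)) := by
  have hS : S.card ≤ c := by
    by_contra! h
    rw [hx.component_eq_zero hnil h, map_zero, map_zero, LinearMap.zero_apply] at h0
    exact h0 rfl
  have hw : (vars w).card ≤ c := by
    by_contra! h
    rw [lift_eq_zero hnil x (h.trans_le (card_vars_le w)), map_zero] at h0
    exact h0 rfl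
  obtain ⟨u, η, h1, h2, h3, rfl⟩ := exists_fresh_monomial S w
    (by rw [Fintype.card_fin]; omega) θ hi
  exact ⟨u, η, h1, h2, by rw [map_sideMul, subst_lift, hx.subst_component_congr h3]⟩

/-- The series is stable under substitutions of variables, because a product to be tested can first
be moved to fresh variables. -/
theorem subst_mem_annSeries (hn : 2 * c ≤ n) (hc : 1 ≤ c) (θ : Fin n → Fin n) {t : ℕ} {y : P}
    (hy : y ∈ hx.annSeries t) : hx.subst θ y ∈ hx.annSeries t := by
  induction t generalizing θ y with
  | zero =>
    rw [mem_annSeries_zero] at hy ⊢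
    rw [hy, map_zero]
  | succ t ih =>
    intro b R a
    rw [component_subst, map_sum, LinearMap.sum_apply]
    refine Submodule.sum_mem _ fun S _ => ?_
    split_ifs
    swap
    · rw [map_zero, LinearMap.zero_apply]; exact Submodule.zero_mem _
    refine hx.induction_on a (fun w => ?_) ?_ (fun a a' h1 h2 => ?_) fun r a h1 => ?_
    · by_cases h0 : sideMul 𝔽 b (hx.subst θ (hx.component S y)) (FreeMagma.lift x w) = 0
      · rw [h0]; exact Submodule.zero_mem _
      · have hS : S.card ≤ c := by
          by_contra! h
          rw [hx.component_eq_zero hnil h, map_zero, map_zero, LinearMap.zero_apply] at h0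
          exact h0 rfl
        obtain ⟨i, hi⟩ : ∃ i, i ∉ S := by
          by_contra! h
          have h' : S = Finset.univ := Finset.eq_univ_iff_forall.2 h
          rw [h', Finset.card_univ, Fintype.card_fin] at hS
          omega
        obtain ⟨u, η, -, -, h⟩ := hx.exists_fresh_sideMul hnil hn θ h0 hi
        rw [h]
        exact ih η (hy b S _)
    · rw [map_zero]; exact Submodule.zero_mem _
    · rw [map_add]; exact Submodule.add_mem _ h1 h2
    · rw [map_smul]; exact Submodule.smul_mem _ r h1

/-- If a component is outside a term of the series, then some product of it with a monomial in fresh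
variables, one of them prescribed, is outside the preceding term. -/
theorem exists_fresh_notMem (hn : 2 * c ≤ n) (hc : 1 ≤ c) {t : ℕ} {S : Finset (Fin n)} {y : P}
    (hy : hx.component S y ∉ hx.annSeries (t + 1)) {i : Fin n} (hi : i ∉ S) :
    ∃ b u, Disjoint S (vars u) ∧ i ∈ vars u ∧
      sideMul 𝔽 b (hx.component S y) (FreeMagma.lift x u) ∉ hx.annSeries t := by
  obtain ⟨b, w, h⟩ := hx.exists_sideMul_lift_notMem hy
  have hid : hx.subst id (hx.component S y) = hx.component S y := by
    refine hx.induction_on (hx.component S y) (fun w => ?_) (map_zero _) (fun a a' h1 h2 => ?_)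
      fun r a h1 => ?_
    · rw [subst_lift, map_id]
    · rw [map_add, h1, h2]
    · rw [map_smul, h1]
  obtain ⟨u, η, h1, h2, h3⟩ := hx.exists_fresh_sideMul hnil hn (S := S) (y := y) (b := b)
    (w := w) id (by rw [hid]; exact fun h' => h (h' ▸ Submodule.zero_mem _)) hi
  refine ⟨b, u, h1, h2, fun h' => h ?_⟩
  rw [hid] at h3
  rw [h3]
  exact hx.subst_mem_annSeries hnil hn hc η h'

end Nilpotent

/-! ### Leading supports of an ideal -/

open Classical in
/-- The leading supports of `J` in degree `t`: the colexicographically largest sets on which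
elements of `J` in the term `t + 1` of the series have a component outside the term `t`. -/
noncomputable def leading (J : Submodule 𝔽 P) (t : ℕ) : Finset (Finset (Fin n)) :=
  Finset.univ.filter fun S => ∃ y ∈ J ⊓ hx.annSeries (t + 1), hx.component S y ∉ hx.annSeries t ∧
    ∀ R, toColex S < toColex R → hx.component R y ∈ hx.annSeries t

theorem mem_leading {J : Submodule 𝔽 P} {t : ℕ} {S : Finset (Fin n)} : S ∈ hx.leading J t ↔
    ∃ y ∈ J ⊓ hx.annSeries (t + 1), hx.component S y ∉ hx.annSeries t ∧
      ∀ R, toColex S < toColex R → hx.component R y ∈ hx.annSeries t := by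
  simp [leading]

theorem exists_mem_leading {J : Submodule 𝔽 P} {t : ℕ} {y : P}
    (hy : y ∈ J ⊓ hx.annSeries (t + 1)) (hyt : y ∉ hx.annSeries t) :
    ∃ S ∈ hx.leading J t, hx.component S y ∉ hx.annSeries t := by
  classical
  have hne : (Finset.univ.filter fun S => hx.component S y ∉ hx.annSeries t).Nonempty := by
    by_contra! h
    refine hyt ?_
    rw [← hx.sum_component y]
    refine Submodule.sum_mem _ fun S _ => ?_
    by_contra hS
    have : S ∈ Finset.univ.filter fun S => hx.component S y ∉ hx.annSeries t := by simpa using hS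
    rw [h] at this
    exact absurd this (Finset.notMem_empty S)
  obtain ⟨S, hS, hmax⟩ := Finset.exists_max_image _ (fun S => toColex S) hne
  rw [Finset.mem_filter] at hS
  refine ⟨S, hx.mem_leading.2 ⟨y, hy, hS.2, fun R hR => ?_⟩, hS.2⟩
  by_contra h
  exact absurd (hmax R (by simpa using h)) (not_le.2 hR)

theorem _root_.Finset.Colex.union_lt_union {X : Type*} [LinearOrder X] {R S T : Finset X}
    (h : toColex R < toColex S) (hST : Disjoint S T) :
    toColex (R ∪ T) < toColex (S ∪ T) := by
  obtain ⟨a, ha, haR, hmax⟩ := Finset.Colex.toColex_lt_toColex_iff_exists_forall_lt.1 h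
  refine Finset.Colex.toColex_lt_toColex_iff_exists_forall_lt.2 ⟨a, ?_, ?_, fun b hb hbS => ?_⟩
  · exact Finset.mem_union_left _ ha
  · rw [Finset.mem_union, not_or]
    exact ⟨haR, Finset.disjoint_left.1 hST ha⟩
  · rw [Finset.mem_union, not_or] at hbS
    exact hmax b ((Finset.mem_union.1 hb).resolve_right hbS.2) hbS.1

section Nilpotent

variable {c : ℕ} (hnil : (power 𝔽 P (c + 1)).toSubmodule = ⊥)

include hnil

theorem card_le_of_mem_leading {J : Submodule 𝔽 P} {t : ℕ} {S : Finset (Fin n)}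
    (hS : S ∈ hx.leading J t) : S.card ≤ c := by
  obtain ⟨y, -, h, -⟩ := hx.mem_leading.1 hS
  by_contra! hc
  rw [hx.component_eq_zero hnil hc] at h
  exact h (Submodule.zero_mem _)

/-- Multiplication by a monomial in fresh variables turns a leading support into a larger one, one
degree lower. -/
theorem exists_leading_of_leading_succ (hn : 2 * c ≤ n) (hc : 1 ≤ c) (J : AlgIdeal 𝔽 P) {t : ℕ}
    {S : Finset (Fin n)} (hS : S ∈ hx.leading J.toSubmodule (t + 1)) {i : Fin n} (hi : i ∉ S) :
    ∃ R ∈ hx.leading J.toSubmodule t, S ⊆ R ∧ i ∈ R := by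
  obtain ⟨y, hy, hyS, hmax⟩ := hx.mem_leading.1 hS
  obtain ⟨b, u, hdisj, hiu, hu⟩ := hx.exists_fresh_notMem hnil hn hc hyS hi
  refine ⟨S ∪ vars u, hx.mem_leading.2 ⟨sideMul 𝔽 b y (FreeMagma.lift x u),
    ⟨J.sideMul_mem hy.1 b _, hx.sideMul_mem_annSeries hy.2 b _⟩, ?_, fun R hR => ?_⟩,
    Finset.subset_union_left, Finset.mem_union_right _ hiu⟩
  · rw [component_sideMul]
    rw [← Finset.add_sum_erase _ _ (Finset.mem_univ S), if_pos rfl]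
    intro h
    refine hu ((Submodule.add_mem_iff_left _ (Submodule.sum_mem _ fun R hR => ?_)).1 h)
    split_ifs with hRS
    · rcases lt_trichotomy (toColex R) (toColex S) with hlt | heq | hgt
      · exact absurd (congrArg toColex hRS) (Finset.Colex.union_lt_union hlt hdisj).ne
      · exact absurd (toColex_inj.1 heq) (Finset.ne_of_mem_erase hR)
      · exact hx.sideMul_mem_annSeries (hmax R hgt) b _
    · exact Submodule.zero_mem _
  · rw [component_sideMul]
    refine Submodule.sum_mem _ fun S' _ => ?_
    split_ifs with hRS
    · refine hx.sideMul_mem_annSeries (hmax S' ?_) b _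
      rcases lt_trichotomy (toColex S') (toColex S) with hlt | heq | hgt
      · have h := Finset.Colex.union_lt_union hlt hdisj
        rw [hRS] at h
        exact absurd h hR.not_gt
      · rw [toColex_inj.1 heq] at hRS
        rw [hRS] at hR
        exact absurd hR (lt_irrefl _)
      · exact hgt
    · exact Submodule.zero_mem _

/-- Double counting of the pairs of a leading support and a larger one, one degree lower. -/
theorem card_leading_succ_mul_le (hn : 2 * c ≤ n) (hc : 1 ≤ c) (J : AlgIdeal 𝔽 P) (t : ℕ) :
    (hx.leading J.toSubmodule (t + 1)).card * ((n - c) / c) ≤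
      (hx.leading J.toSubmodule t).card * 2 ^ c := by
  classical
  refine Finset.card_mul_le_card_mul (fun S R => S ⊆ R) (fun S hS => ?_) fun R hR => ?_
  · refine Nat.div_le_of_le_mul ?_
    -- the leading supports that contain `S` cover the complement of `S`
    have hcov : Sᶜ ⊆ ((hx.leading J.toSubmodule t).bipartiteAbove (fun S R => S ⊆ R) S).biUnion
        id := by
      intro i hi
      obtain ⟨R, hR, h1, h2⟩ :=
        hx.exists_leading_of_leading_succ hnil hn hc J hS (Finset.mem_compl.1 hi)
      exact Finset.mem_biUnion.2 ⟨R, (Finset.mem_bipartiteAbove _).2 ⟨hR, h1⟩, h2⟩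
    have h1 : Sᶜ.card = n - S.card := by rw [Finset.card_compl, Fintype.card_fin]
    have h2 := hx.card_le_of_mem_leading hnil hS
    have h3 := (Finset.card_le_card hcov).trans (Finset.card_biUnion_le_card_mul _ _ c fun R hR =>
      hx.card_le_of_mem_leading hnil ((Finset.mem_bipartiteAbove _).1 hR).1)
    rw [h1, mul_comm] at h3
    omega
  · calc _ ≤ R.powerset.card := Finset.card_le_card fun S hS =>
          Finset.mem_powerset.2 ((Finset.mem_bipartiteBelow _).1 hS).2
      _ = 2 ^ R.card := Finset.card_powerset R
      _ ≤ 2 ^ c := Nat.pow_le_pow_right (by norm_num) (hx.card_le_of_mem_leading hnil hR)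

/-- An element of `J` in one term of the series belongs to the preceding term as soon as its
components on the leading supports vanish. -/
theorem finrank_inf_annSeries_succ_le (J : Submodule 𝔽 P) (t : ℕ) :
    Module.finrank 𝔽 (J ⊓ hx.annSeries (t + 1) : Submodule 𝔽 P) ≤
      Module.finrank 𝔽 (J ⊓ hx.annSeries t : Submodule 𝔽 P) +
        (hx.leading J t).card * numMonomials c := by
  have := hx.finiteDimensional hnil
  let f : (J ⊓ hx.annSeries (t + 1) : Submodule 𝔽 P) →ₗ[𝔽]
      ((S : hx.leading J t) → LinearMap.range (hx.component (S : Finset (Fin n)))) :=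
    LinearMap.pi fun S => (hx.component (S : Finset (Fin n))).rangeRestrict.comp
      (Submodule.subtype _)
  have h1 : Module.finrank 𝔽 (LinearMap.range f) ≤ (hx.leading J t).card * numMonomials c := by
    refine (Submodule.finrank_le _).trans ?_
    rw [Module.finrank_pi_fintype]
    refine (Finset.sum_le_card_nsmul _ _ (numMonomials c) fun S _ =>
      hx.finrank_range_component_le hnil _).trans ?_
    rw [Finset.card_univ, Fintype.card_coe, smul_eq_mul]
  have h2 : Module.finrank 𝔽 (LinearMap.ker f) ≤
      Module.finrank 𝔽 (J ⊓ hx.annSeries t : Submodule 𝔽 P) := by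
    rw [← Submodule.finrank_map_subtype_eq]
    refine Submodule.finrank_mono ?_
    rintro _ ⟨⟨y, hy⟩, hyf, rfl⟩
    refine ⟨hy.1, ?_⟩
    change y ∈ hx.annSeries t
    by_contra hyt
    obtain ⟨S, hS, hyS⟩ := hx.exists_mem_leading hy hyt
    refine hyS ?_
    have h : hx.component S y = 0 :=
      congrArg Subtype.val (congrFun (LinearMap.mem_ker.1 hyf) ⟨S, hS⟩)
    rw [h]
    exact Submodule.zero_mem _
  have h3 := LinearMap.finrank_range_add_finrank_ker f
  omega

/-- Elements of `J` with distinct leading supports are linearly independent. -/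
theorem card_leading_zero_le (J : Submodule 𝔽 P) :
    (hx.leading J 0).card ≤ Module.finrank 𝔽 (J ⊓ hx.annSeries 1 : Submodule 𝔽 P) := by
  classical
  have := hx.finiteDimensional hnil
  have h : ∀ S : hx.leading J 0, ∃ y : (J ⊓ hx.annSeries 1 : Submodule 𝔽 P),
      hx.component S y ≠ 0 ∧ ∀ R, toColex (S : Finset (Fin n)) < toColex R →
        hx.component R y = 0 := by
    intro S
    obtain ⟨y, hy, h1, h2⟩ := hx.mem_leading.1 S.2
    exact ⟨⟨y, hy⟩, fun h => h1 (hx.mem_annSeries_zero.2 h), fun R hR =>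
      hx.mem_annSeries_zero.1 (h2 R hR)⟩
  choose y hy hmax using h
  have hli : LinearIndependent 𝔽 y := by
    rw [Fintype.linearIndependent_iff]
    intro g hg
    by_contra! hne
    obtain ⟨S, hS, hSmax⟩ := Finset.exists_max_image (Finset.univ.filter fun S => g S ≠ 0)
      (fun S => toColex (S : Finset (Fin n))) (by
        obtain ⟨S, hS⟩ := hne
        exact ⟨S, by simpa using hS⟩)
    rw [Finset.mem_filter] at hS
    have h0 := congrArg (fun z : (J ⊓ hx.annSeries 1 : Submodule 𝔽 P) =>
      hx.component (S : Finset (Fin n)) z) hg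
    simp only [AddSubmonoidClass.coe_finsetSum, map_sum, Submodule.coe_smul, map_smul,
      Submodule.coe_zero, map_zero] at h0
    rw [Finset.sum_eq_single S] at h0
    · exact (smul_ne_zero hS.2 (hy S)) h0
    · intro R _ hRS
      by_cases hgR : g R = 0
      · rw [hgR, zero_smul]
      · have hle := hSmax R (by simpa using hgR)
        rw [hmax R S (lt_of_le_of_ne hle fun h => hRS (Subtype.ext (toColex_inj.1 h))), smul_zero]
    · intro h; exact absurd (Finset.mem_univ _) h
  simpa using hli.fintype_card_le_finrank

end Nilpotent

include hx in
/-- In a relatively free algebra of large rank, an ideal whose image modulo the annihilator has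
dimension `j` meets the annihilator in a subspace whose dimension is at least a constant multiple
of `j n`; the constant depends on the nilpotency class only. -/
theorem finrank_ideal_le {c : ℕ} (hnil : (power 𝔽 P (c + 1)).toSubmodule = ⊥)
    (hcentral : (annihilator 𝔽 P).toSubmodule = (power 𝔽 P c).toSubmodule) (hn : 2 * c ≤ n)
    (hc : 1 ≤ c) (hm : 2 ^ c ≤ (n - c) / c) (J : AlgIdeal 𝔽 P) :
    (Module.finrank 𝔽 J.toSubmodule -
      Module.finrank 𝔽 (J.toSubmodule ⊓ (power 𝔽 P c).toSubmodule : Submodule 𝔽 P)) *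
        ((n - c) / c) ≤ (c * numMonomials c * 2 ^ c) *
      Module.finrank 𝔽 (J.toSubmodule ⊓ (power 𝔽 P c).toSubmodule : Submodule 𝔽 P) := by
  set m := (n - c) / c
  set K := numMonomials c
  have hlead : ∀ t, (hx.leading J.toSubmodule (t + 1)).card * m ≤
      (hx.leading J.toSubmodule 0).card * 2 ^ c := by
    intro t
    induction t with
    | zero => exact hx.card_leading_succ_mul_le hnil hn hc J 0
    | succ t ih =>
      refine (hx.card_leading_succ_mul_le hnil hn hc J (t + 1)).trans (le_trans ?_ ih)
      exact Nat.mul_le_mul_left _ hm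
  have hdim : ∀ t, Module.finrank 𝔽 (J.toSubmodule ⊓ hx.annSeries (t + 1) : Submodule 𝔽 P) * m ≤
      Module.finrank 𝔽 (J.toSubmodule ⊓ hx.annSeries 1 : Submodule 𝔽 P) * m +
        t * (K * 2 ^ c * (hx.leading J.toSubmodule 0).card) := by
    intro t
    induction t with
    | zero => simp
    | succ t ih =>
      have h1 := Nat.mul_le_mul_right m
        (hx.finrank_inf_annSeries_succ_le hnil J.toSubmodule (t + 1))
      have h2 := Nat.mul_le_mul_left K (hlead t)
      nlinarith
  obtain ⟨t, rfl⟩ : ∃ t, c = t + 1 := ⟨c - 1, by omega⟩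
  have h1 := hdim t
  rw [hx.annSeries_class hnil, inf_top_eq, hx.annSeries_one hnil hc hcentral] at h1
  have h2 := hx.card_leading_zero_le hnil J.toSubmodule
  rw [hx.annSeries_one hnil hc hcentral] at h2
  have h3 := Nat.mul_le_mul_left (t * (K * 2 ^ (t + 1))) h2
  rw [Nat.sub_mul]
  refine Nat.sub_le_iff_le_add'.2 (h1.trans (Nat.add_le_add_left ?_ _))
  have h4 : t * (K * 2 ^ (t + 1)) ≤ (t + 1) * K * 2 ^ (t + 1) := by
    rw [mul_assoc]; exact Nat.mul_le_mul_right _ (Nat.le_succ t)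
  calc _ = t * (K * 2 ^ (t + 1)) * (hx.leading J.toSubmodule 0).card := by ring
    _ ≤ _ := h3
    _ ≤ _ := Nat.mul_le_mul_right _ h4

end IsRelFree

end AnnihilatorSeries
/-! ### Counting subspaces -/

section Subspaces

variable {𝔽 : Type*} [Field 𝔽] [Finite 𝔽]
variable {W B E : Type*} [AddCommGroup W] [Module 𝔽 W] [FiniteDimensional 𝔽 W]
  [AddCommGroup B] [Module 𝔽 B] [FiniteDimensional 𝔽 B]
  [AddCommGroup E] [Module 𝔽 E] [FiniteDimensional 𝔽 E]

variable (𝔽) in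
theorem finite_of_finiteDimensional (E : Type*) [AddCommGroup E] [Module 𝔽 E]
    [FiniteDimensional 𝔽 E] : Finite E := Module.finite_of_finite 𝔽

variable (𝔽) in
theorem finite_submodule (E : Type*) [AddCommGroup E] [Module 𝔽 E]
    [FiniteDimensional 𝔽 E] : Finite (Submodule 𝔽 E) :=
  have := finite_of_finiteDimensional 𝔽 E
  Finite.of_injective (fun K : Submodule 𝔽 E => (K : Set E)) SetLike.coe_injective

variable (𝔽) in
theorem natCard_linearMap (W B : Type*) [AddCommGroup W] [Module 𝔽 W] [FiniteDimensional 𝔽 W]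
    [AddCommGroup B] [Module 𝔽 B] [FiniteDimensional 𝔽 B] :
    Nat.card (W →ₗ[𝔽] B) = Nat.card 𝔽 ^ (Module.finrank 𝔽 W * Module.finrank 𝔽 B) := by
  rw [Module.natCard_eq_pow_finrank (K := 𝔽), Module.finrank_linearMap]

/-- Graphs of linear maps from subspaces of `W` to `B` are distinct subspaces of `W × B`. -/
theorem graph_sigma_injective : Function.Injective
    (fun s : Σ U : Submodule 𝔽 W, (U →ₗ[𝔽] B) => LinearMap.range (s.1.subtype.prod s.2)) := by
  have key : ∀ (U U' : Submodule 𝔽 W) (f : U →ₗ[𝔽] B) (f' : U' →ₗ[𝔽] B),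
      LinearMap.range (U.subtype.prod f) = LinearMap.range (U'.subtype.prod f') →
      ∀ u : U, ∃ u' : U', (u' : W) = u ∧ f' u' = f u := by
    intro U U' f f' h u
    have hu : ((u : W), f u) ∈ LinearMap.range (U'.subtype.prod f') := h ▸ ⟨u, rfl⟩
    obtain ⟨u', hu'⟩ := hu
    exact ⟨u', congrArg Prod.fst hu', congrArg Prod.snd hu'⟩
  rintro ⟨U, f⟩ ⟨U', f'⟩ h
  obtain rfl : U = U' := by
    apply le_antisymm
    · intro u hu
      obtain ⟨u', h1, -⟩ := key U U' f f' h ⟨u, hu⟩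
      have h1 : (u' : W) = u := h1
      exact h1 ▸ u'.2
    · intro u hu
      obtain ⟨u', h1, -⟩ := key U' U f' f h.symm ⟨u, hu⟩
      have h1 : (u' : W) = u := h1
      exact h1 ▸ u'.2
  have : f = f' := by
    ext u
    obtain ⟨u', h1, h2⟩ := key U U f f' h u
    rw [← h2, Subtype.ext h1]
  rw [this]

/-- Linear maps from `B` to quotients of `W` define distinct subspaces of `W × B`. -/
theorem cograph_sigma_injective : Function.Injective
    (fun s : Σ U : Submodule 𝔽 W, (B →ₗ[𝔽] W ⧸ U) =>
      LinearMap.ker (s.1.mkQ.comp (LinearMap.fst 𝔽 W B) - s.2.comp (LinearMap.snd 𝔽 W B))) := by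
  have hmem : ∀ (U : Submodule 𝔽 W) (g : B →ₗ[𝔽] W ⧸ U) (w : W) (b : B), (w, b) ∈ LinearMap.ker
      (U.mkQ.comp (LinearMap.fst 𝔽 W B) - g.comp (LinearMap.snd 𝔽 W B)) ↔ U.mkQ w = g b := by
    intro U g w b
    rw [LinearMap.mem_ker, LinearMap.sub_apply, sub_eq_zero]
    rfl
  rintro ⟨U, g⟩ ⟨U', g'⟩ h
  have key : ∀ w b, U.mkQ w = g b ↔ U'.mkQ w = g' b := by
    intro w b
    rw [← hmem, ← hmem]
    exact (SetLike.ext_iff.1 h) (w, b)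
  obtain rfl : U = U' := by
    ext w
    have := key w 0
    rw [map_zero, map_zero] at this
    simpa using this
  have : g = g' := by
    ext b
    obtain ⟨w, hw⟩ := U.mkQ_surjective (g b)
    rw [← hw]
    exact (key w b).1 hw
  rw [this]

/-- Passing from a space to its product with a space of dimension `b` multiplies the number of
subspaces by a factor that is exponential in `b`. -/
theorem pow_mul_card_submodule_le :
    Nat.card 𝔽 ^ ((Module.finrank 𝔽 W + 1) / 2 * Module.finrank 𝔽 B) * Nat.card (Submodule 𝔽 W) ≤
      2 * Nat.card (Submodule 𝔽 (W × B)) := by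
  have := finite_submodule 𝔽 W
  have := finite_submodule 𝔽 (W × B)
  have := Fintype.ofFinite (Submodule 𝔽 W)
  have hq : 1 ≤ Nat.card 𝔽 := Nat.card_pos
  set b := Module.finrank 𝔽 B
  set w := Module.finrank 𝔽 W with hw
  have hfin1 : ∀ U : Submodule 𝔽 W, Finite (U →ₗ[𝔽] B) := fun U =>
    finite_of_finiteDimensional 𝔽 _
  have hfin2 : ∀ U : Submodule 𝔽 W, Finite (B →ₗ[𝔽] W ⧸ U) := fun U =>
    finite_of_finiteDimensional 𝔽 _
  have h1 := Nat.card_le_card_of_injective _ (graph_sigma_injective (𝔽 := 𝔽) (W := W) (B := B))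
  have h2 := Nat.card_le_card_of_injective _ (cograph_sigma_injective (𝔽 := 𝔽) (W := W) (B := B))
  rw [Nat.card_sigma] at h1 h2
  rw [two_mul]
  refine le_trans ?_ (add_le_add h1 h2)
  rw [← Finset.sum_add_distrib, Nat.card_eq_fintype_card (α := Submodule 𝔽 W), mul_comm,
    ← smul_eq_mul]
  refine Finset.card_nsmul_le_sum _ _ _ fun U _ => ?_
  rw [natCard_linearMap, natCard_linearMap]
  -- either `U` or the quotient by `U` has at least half the dimension of `W`
  have hU := U.finrank_quotient_add_finrank
  rcases le_or_gt ((w + 1) / 2) (Module.finrank 𝔽 U) with h | h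
  · exact le_add_right (Nat.pow_le_pow_right hq (Nat.mul_le_mul_right _ h))
  · refine le_add_left (Nat.pow_le_pow_right hq ?_)
    rw [mul_comm]
    exact Nat.mul_le_mul_left _ (by omega)

/-- The subspaces of `E` that contain a given subspace of not too small dimension are few among all
subspaces of `E`. -/
theorem card_submodule_ge_mul_pow_le {β : ℕ} {B₀ : Submodule 𝔽 E}
    (hB : 4 * β ≤ Module.finrank 𝔽 B₀) (hE : 8 * β ≤ Module.finrank 𝔽 E) :
    Nat.card {K : Submodule 𝔽 E // B₀ ≤ K} * Nat.card 𝔽 ^ (Module.finrank 𝔽 E * β) ≤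
      2 * Nat.card (Submodule 𝔽 E) := by
  obtain ⟨B, hBB, hfr⟩ : ∃ B ≤ B₀, Module.finrank 𝔽 B = 4 * β := by
    obtain ⟨f, hf⟩ := exists_linearIndependent_of_le_finrank hB
    refine ⟨(Submodule.span 𝔽 (Set.range f)).map B₀.subtype, Submodule.map_subtype_le _ _, ?_⟩
    rw [Submodule.finrank_map_subtype_eq, finrank_span_eq_card hf, Fintype.card_fin]
  have := finite_submodule 𝔽 E
  have := finite_submodule 𝔽 (E ⧸ B)
  have h1 : Nat.card {K : Submodule 𝔽 E // B₀ ≤ K} ≤ Nat.card (Submodule 𝔽 (E ⧸ B)) := by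
    rw [Nat.card_congr (Submodule.comapMkQRelIso B).toEquiv]
    exact Nat.card_le_card_of_injective
      (fun K : {K : Submodule 𝔽 E // B₀ ≤ K} => (⟨K.1, hBB.trans K.2⟩ : Set.Ici B))
      fun K K' h => Subtype.ext (congrArg (fun L : Set.Ici B => (L : Submodule 𝔽 E)) h)
  have hq : 1 ≤ Nat.card 𝔽 := Nat.card_pos
  have hquot := B.finrank_quotient_add_finrank
  have e : ((E ⧸ B) × B) ≃ₗ[𝔽] E := LinearEquiv.ofFinrankEq _ _ (by
    rw [Module.finrank_prod]; exact hquot)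
  have h2 := pow_mul_card_submodule_le (𝔽 := 𝔽) (W := E ⧸ B) (B := B)
  rw [Nat.card_congr (Submodule.orderIsoMapComap e).toEquiv] at h2
  refine le_trans ?_ h2
  rw [mul_comm]
  refine Nat.mul_le_mul (Nat.pow_le_pow_right hq ?_) h1
  rw [hfr, ← mul_assoc]
  exact Nat.mul_le_mul_right _ (by omega)

end Subspaces
/-! ### Counting ideals -/

section Ideals

variable {𝔽 : Type u} [Field 𝔽] [Finite 𝔽]
variable {P : Type v} [NonUnitalNonAssocRing P] [Module 𝔽 P] [IsScalarTower 𝔽 P P]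
  [SMulCommClass 𝔽 P P] [FiniteDimensional 𝔽 P]

variable (𝔽 P) in
theorem finite_algIdeal : Finite (AlgIdeal 𝔽 P) :=
  have := finite_submodule 𝔽 P
  Finite.of_injective _ AlgIdeal.toSubmodule_injective

/-- The dimension of the image of the ideal `J` modulo the subspace `A`. -/
noncomputable def excess (A : Submodule 𝔽 P) (J : AlgIdeal 𝔽 P) : ℕ :=
  Module.finrank 𝔽 J.toSubmodule - Module.finrank 𝔽 (J.toSubmodule ⊓ A : Submodule 𝔽 P)

/-- An ideal `J` is generated, as a subspace, by `J ⊓ A` and as many further elements as the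
dimension of its image modulo `A`; the ideal generated by these elements has at least the same
excess over `A`. -/
theorem exists_excess_generators (A : Submodule 𝔽 P) (J : AlgIdeal 𝔽 P) :
    ∃ y : Fin (excess A J) → P,
      Submodule.span 𝔽 (Set.range y) ⊔ (J.toSubmodule ⊓ A) = J.toSubmodule ∧
      (idealSpan 𝔽 (Set.range y)).toSubmodule ≤ J.toSubmodule ∧
      excess A J ≤ excess A (idealSpan 𝔽 (Set.range y)) := by
  obtain ⟨Q, hQ⟩ := Submodule.exists_isCompl (J.toSubmodule ⊓ A)
  have hsup : (Q ⊓ J.toSubmodule) ⊔ (J.toSubmodule ⊓ A) = J.toSubmodule := by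
    rw [sup_comm, ← sup_inf_assoc_of_le Q inf_le_left, hQ.sup_eq_top, top_inf_eq]
  have hdisj : Disjoint (Q ⊓ J.toSubmodule) (J.toSubmodule ⊓ A) :=
    hQ.symm.disjoint.mono_left inf_le_left
  have hfr : Module.finrank 𝔽 (Q ⊓ J.toSubmodule : Submodule 𝔽 P) = excess A J := by
    have h := Submodule.finrank_sup_add_finrank_inf_eq (Q ⊓ J.toSubmodule) (J.toSubmodule ⊓ A)
    rw [hsup, hdisj.eq_bot, finrank_bot] at h
    rw [excess]
    omega
  let B := Module.finBasisOfFinrankEq 𝔽 _ hfr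
  have hspan : Submodule.span 𝔽 (Set.range fun i => (B i : P)) = Q ⊓ J.toSubmodule := by
    have h : Set.range (fun i => (B i : P)) = (Q ⊓ J.toSubmodule).subtype '' Set.range B := by
      rw [← Set.range_comp]; rfl
    rw [h, Submodule.span_image, B.span_eq, Submodule.map_top, Submodule.range_subtype]
  have hJ : (idealSpan 𝔽 (Set.range fun i => (B i : P))).toSubmodule ≤ J.toSubmodule :=
    idealSpan_le (by rintro _ ⟨i, rfl⟩; exact (B i).2.2)
  refine ⟨fun i => (B i : P), by rw [hspan, hsup], hJ, ?_⟩
  set I := idealSpan 𝔽 (Set.range fun i => (B i : P))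
  have hle : (Q ⊓ J.toSubmodule) ⊔ (I.toSubmodule ⊓ A) ≤ I.toSubmodule := by
    refine sup_le ?_ inf_le_left
    rw [← hspan]
    exact Submodule.span_le.2 (subset_idealSpan _)
  have hdisj' : Disjoint (Q ⊓ J.toSubmodule) (I.toSubmodule ⊓ A) :=
    hdisj.mono_right (inf_le_inf_right A hJ)
  have h := Submodule.finrank_sup_add_finrank_inf_eq (Q ⊓ J.toSubmodule) (I.toSubmodule ⊓ A)
  rw [hdisj'.eq_bot, finrank_bot, hfr] at h
  have h2 := Submodule.finrank_mono hle
  rw [excess.eq_def A I]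
  omega

/-- An ideal `J` of excess `j` is determined by the `j` additional generators and by `J ⊓ A`, which
contains the large intersection of `A` with the ideal that these elements generate. -/
theorem card_excess_eq_mul_pow_le {A : Submodule 𝔽 P} {Λ m M j : ℕ} (hΛ : 0 < Λ)
    (hm : 8 * M * Λ ≤ m) (hP : Module.finrank 𝔽 P ≤ 2 * Module.finrank 𝔽 A)
    (hkey : ∀ J : AlgIdeal 𝔽 P,
      excess A J * m ≤ Λ * Module.finrank 𝔽 (J.toSubmodule ⊓ A : Submodule 𝔽 P)) :
    Nat.card {J : AlgIdeal 𝔽 P // excess A J = j} *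
        Nat.card 𝔽 ^ (Module.finrank 𝔽 A * (M * j)) ≤
      Nat.card 𝔽 ^ (Module.finrank 𝔽 A * (2 * j)) * (2 * Nat.card (Submodule 𝔽 A)) := by
  have := finite_of_finiteDimensional 𝔽 P
  have := finite_algIdeal 𝔽 P
  have := finite_submodule 𝔽 A
  have hq : 1 ≤ Nat.card 𝔽 := Nat.card_pos
  set D := Module.finrank 𝔽 A with hD
  rcases isEmpty_or_nonempty {J : AlgIdeal 𝔽 P // excess A J = j} with hemp | ⟨⟨J₀, hJ₀⟩⟩
  · rw [Nat.card_of_isEmpty, zero_mul]; exact Nat.zero_le _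
  have hbound : ∀ J : AlgIdeal 𝔽 P, j ≤ excess A J →
      8 * (M * j) ≤ Module.finrank 𝔽 (J.toSubmodule ⊓ A : Submodule 𝔽 P) := by
    intro J hJ
    refine Nat.le_of_mul_le_mul_left (le_trans ?_ (hkey J)) hΛ
    calc Λ * (8 * (M * j)) = j * (8 * M * Λ) := by ring
      _ ≤ _ := Nat.mul_le_mul hJ hm
  have hDj : 8 * (M * j) ≤ D := (hbound J₀ hJ₀.ge).trans (Submodule.finrank_mono inf_le_right)
  let bot : (Fin j → P) → Submodule 𝔽 A := fun y =>
    (idealSpan 𝔽 (Set.range y)).toSubmodule.comap A.subtype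
  let good : Set (Fin j → P) := {y | 4 * (M * j) ≤ Module.finrank 𝔽 (bot y)}
  have hex : ∀ J : {J : AlgIdeal 𝔽 P // excess A J = j}, ∃ y : Fin j → P, y ∈ good ∧
      bot y ≤ J.1.toSubmodule.comap A.subtype ∧
      Submodule.span 𝔽 (Set.range y) ⊔ (J.1.toSubmodule ⊓ A) = J.1.toSubmodule := by
    rintro ⟨J, rfl⟩
    obtain ⟨y, h1, h2, h3⟩ := exists_excess_generators A J
    refine ⟨y, ?_, Submodule.comap_mono h2, h1⟩
    have h4 : Module.finrank 𝔽 (bot y) = Module.finrank 𝔽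
        ((idealSpan 𝔽 (Set.range y)).toSubmodule ⊓ A : Submodule 𝔽 P) := by
      rw [← Submodule.finrank_map_subtype_eq A (bot y), Submodule.map_comap_subtype, inf_comm]
    have h5 := hbound _ h3
    change 4 * (M * _) ≤ Module.finrank 𝔽 (bot y)
    rw [h4]
    omega
  choose y hgood hbot hspan using hex
  have hcard : Nat.card {J : AlgIdeal 𝔽 P // excess A J = j} ≤
      Nat.card (Σ y : good, {K : Submodule 𝔽 A // bot y ≤ K}) := by
    refine Nat.card_le_card_of_injective
      (fun J => ⟨⟨y J, hgood J⟩, ⟨J.1.toSubmodule.comap A.subtype, hbot J⟩⟩) fun J J' h => ?_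
    have hy : y J = y J' := congrArg (fun s : Σ y : good, {K : Submodule 𝔽 A // bot y ≤ K} =>
      (s.1 : Fin j → P)) h
    have hK : J.1.toSubmodule.comap A.subtype = J'.1.toSubmodule.comap A.subtype :=
      congrArg (fun s : Σ y : good, {K : Submodule 𝔽 A // bot y ≤ K} => s.2.1) h
    have hK' := congrArg (Submodule.map A.subtype) hK
    rw [Submodule.map_comap_subtype, Submodule.map_comap_subtype, inf_comm, inf_comm A] at hK'
    refine Subtype.ext (AlgIdeal.toSubmodule_injective ?_)
    rw [← hspan J, ← hspan J', hy, hK']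
  have := Fintype.ofFinite good
  rw [Nat.card_sigma] at hcard
  refine (Nat.mul_le_mul_right _ hcard).trans ?_
  rw [Finset.sum_mul]
  refine (Finset.sum_le_card_nsmul _ _ (2 * Nat.card (Submodule 𝔽 A)) fun y _ =>
    card_submodule_ge_mul_pow_le y.2 hDj).trans ?_
  rw [smul_eq_mul]
  refine Nat.mul_le_mul_right _ ?_
  rw [Finset.card_univ, ← Nat.card_eq_fintype_card]
  refine (Finite.card_subtype_le _).trans ?_
  rw [Nat.card_fun, Nat.card_fin, Module.natCard_eq_pow_finrank (K := 𝔽), ← pow_mul]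
  refine Nat.pow_le_pow_right hq ?_
  calc _ ≤ 2 * D * j := Nat.mul_le_mul_right _ hP
    _ = _ := by ring

theorem excess_eq_zero_iff {A : Submodule 𝔽 P} {J : AlgIdeal 𝔽 P} :
    excess A J = 0 ↔ J.toSubmodule ≤ A := by
  rw [excess, Nat.sub_eq_zero_iff_le]
  constructor
  · intro h
    exact inf_eq_left.1 (Submodule.eq_of_le_of_finrank_le inf_le_left h)
  · intro h
    rw [inf_eq_left.2 h]

/-- If the ideals of `P` have large intersections with `A` in comparison with their images modulo
`A`, then the number of ideals that are not contained in `A` is much smaller than the number of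
subspaces of `A`. -/
theorem card_not_le_mul_pow_le {A : Submodule 𝔽 P} {Λ m M : ℕ} (hΛ : 0 < Λ)
    (hm : 8 * (M + 2) * Λ ≤ m) (hP : Module.finrank 𝔽 P ≤ 2 * Module.finrank 𝔽 A)
    (hkey : ∀ J : AlgIdeal 𝔽 P,
      excess A J * m ≤ Λ * Module.finrank 𝔽 (J.toSubmodule ⊓ A : Submodule 𝔽 P)) :
    Nat.card {J : AlgIdeal 𝔽 P // ¬ J.toSubmodule ≤ A} *
        Nat.card 𝔽 ^ (Module.finrank 𝔽 A * M) ≤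
      Module.finrank 𝔽 A * (2 * Nat.card (Submodule 𝔽 A)) := by
  have := finite_algIdeal 𝔽 P
  have hq : 1 ≤ Nat.card 𝔽 := Nat.card_pos
  set D := Module.finrank 𝔽 A with hD
  set G := Nat.card (Submodule 𝔽 A)
  have hj : ∀ j, 1 ≤ j → Nat.card {J : AlgIdeal 𝔽 P // excess A J = j} *
      Nat.card 𝔽 ^ (D * M) ≤ 2 * G := by
    intro j hj
    have h := card_excess_eq_mul_pow_le (j := j) hΛ hm hP hkey
    rw [← hD, show D * ((M + 2) * j) = D * (M * j) + D * (2 * j) by ring, pow_add, ← mul_assoc,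
      mul_comm (Nat.card 𝔽 ^ (D * (2 * j)))] at h
    refine le_trans ?_ (Nat.le_of_mul_le_mul_right h (pow_pos hq _))
    refine Nat.mul_le_mul_left _ (Nat.pow_le_pow_right hq (Nat.mul_le_mul_left _ ?_))
    exact Nat.le_mul_of_pos_right _ hj
  have hle : ∀ J : AlgIdeal 𝔽 P, excess A J ≤ D := by
    intro J
    have h1 := hkey J
    have h2 : Module.finrank 𝔽 (J.toSubmodule ⊓ A : Submodule 𝔽 P) ≤ D :=
      Submodule.finrank_mono inf_le_right
    refine Nat.le_of_mul_le_mul_left ?_ hΛ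
    calc Λ * excess A J = excess A J * (1 * Λ) := by ring
      _ ≤ excess A J * m := Nat.mul_le_mul_left _ (le_trans (Nat.mul_le_mul_right _ (by omega)) hm)
      _ ≤ _ := h1.trans (Nat.mul_le_mul_left _ h2)
  have hcard : Nat.card {J : AlgIdeal 𝔽 P // ¬ J.toSubmodule ≤ A} ≤
      Nat.card (Σ j : Fin D, {J : AlgIdeal 𝔽 P // excess A J = j + 1}) := by
    have hpos : ∀ J : {J : AlgIdeal 𝔽 P // ¬ J.toSubmodule ≤ A}, 1 ≤ excess A J.1 := fun J =>
      Nat.one_le_iff_ne_zero.2 fun h => J.2 (excess_eq_zero_iff.1 h)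
    refine Nat.card_le_card_of_injective (fun J =>
      ⟨⟨excess A J.1 - 1, by have := hpos J; have := hle J.1; omega⟩,
        ⟨J.1, by have := hpos J; change _ = _ - 1 + 1; omega⟩⟩) fun J J' h => ?_
    exact Subtype.ext (congrArg (fun s : Σ j : Fin D, {J : AlgIdeal 𝔽 P // excess A J = j + 1} =>
      s.2.1) h)
  rw [Nat.card_sigma] at hcard
  refine (Nat.mul_le_mul_right _ hcard).trans ?_
  rw [Finset.sum_mul]
  refine (Finset.sum_le_card_nsmul _ _ (2 * G) fun j _ => hj _ (by omega)).trans ?_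
  rw [smul_eq_mul, Finset.card_univ, Fintype.card_fin]

end Ideals
/-! ### Isomorphic quotients by ideals in the annihilator -/

section Fibers

variable {𝔽 : Type u} [Field 𝔽]
variable {P : Type v} [NonUnitalNonAssocRing P] [Module 𝔽 P] [IsScalarTower 𝔽 P P]
  [SMulCommClass 𝔽 P P] {n : ℕ} {x : Fin n → P}

/-- A subspace of the annihilator as an ideal. -/
def idealOfLe (K : Submodule 𝔽 P) (hK : K ≤ (annihilator 𝔽 P).toSubmodule) : AlgIdeal 𝔽 P where
  toSubmodule := K
  mul_mem_left' a y hy := by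
    change a * y ∈ K
    rw [(hK hy a).1]; exact K.zero_mem
  mul_mem_right' {y} a hy := by
    change y * a ∈ K
    rw [(hK hy a).2]; exact K.zero_mem

namespace IsRelFree

variable (hx : IsRelFree 𝔽 x)
include hx

theorem hom_ext {Q : Type*} [NonUnitalNonAssocRing Q] [Module 𝔽 Q] {φ ψ : P →ₙₐ[𝔽] Q}
    (h : ∀ i, φ (x i) = ψ (x i)) (y : P) : φ y = ψ y := by
  refine hx.induction_on y (fun w => ?_) ?_ (fun y z h1 h2 => ?_) fun r y h1 => ?_
  · rw [map_lift, map_lift]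
    simp only [h]
  · rw [map_zero, map_zero]
  · rw [map_add, map_add, h1, h2]
  · rw [map_smul, map_smul, h1]

/-- An isomorphism of quotients of a relatively free algebra lifts to an endomorphism. -/
theorem exists_lift_of_isomorphic {K L : AlgIdeal 𝔽 P} (h : Isomorphic 𝔽 K.Quot L.Quot) :
    ∃ α : P →ₙₐ[𝔽] P, ∀ y, y ∈ K.toSubmodule ↔ α y ∈ L.toSubmodule := by
  obtain ⟨β, hβ⟩ := h
  choose z hz using fun i => L.projHom_surjective (β (K.projHom (x i)))
  obtain ⟨α, hα⟩ := hx.exists_hom z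
  have hcomp : ∀ y, L.projHom (α y) = β (K.projHom y) := fun y =>
    hx.hom_ext (φ := L.projHom.comp α) (ψ := β.comp K.projHom)
      (fun i => by
        change L.projHom (α (x i)) = β (K.projHom (x i))
        rw [hα, hz]) y
  refine ⟨α, fun y => ?_⟩
  rw [← AlgIdeal.projHom_eq_zero, ← AlgIdeal.projHom_eq_zero, hcomp]
  exact (map_eq_zero_iff β hβ.1).symm

/-- On the annihilator, when it is a higher power of the algebra, an endomorphism depends only on
the images of the generators modulo the annihilator. -/
theorem eq_on_power_of_sub_mem {c : ℕ} (hc : 2 ≤ c)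
    {α β : P →ₙₐ[𝔽] P} (h : ∀ i, α (x i) - β (x i) ∈ (annihilator 𝔽 P).toSubmodule) {y : P}
    (hy : y ∈ (power 𝔽 P c).toSubmodule) : α y = β y := by
  have hsub : ∀ y, α y - β y ∈ (annihilator 𝔽 P).toSubmodule := fun y =>
    AlgIdeal.projHom_eq.1 (hx.hom_ext (φ := (annihilator 𝔽 P).projHom.comp α)
      (ψ := (annihilator 𝔽 P).projHom.comp β) (fun i => AlgIdeal.projHom_eq.2 (h i)) y)
  rw [power_eq_span hx.span_eq_top (by omega)] at hy
  induction hy using Submodule.span_induction with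
  | mem y hy =>
    obtain ⟨w, hw, rfl⟩ := hy
    have hw : c ≤ w.length := hw
    induction w with
    | ih1 i => change c ≤ 1 at hw; omega
    | ih2 a b _ _ =>
      rw [map_mul, map_mul, map_mul]
      have h1 := (hsub (FreeMagma.lift x a) (α (FreeMagma.lift x b))).2
      have h2 := (hsub (FreeMagma.lift x b) (β (FreeMagma.lift x a))).1
      rw [sub_mul, sub_eq_zero] at h1
      rw [mul_sub, sub_eq_zero] at h2
      rw [h1, h2]
  | zero => rw [map_zero, map_zero]
  | add y z _ _ h1 h2 => rw [map_add, map_add, h1, h2]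
  | smul r y _ h1 => rw [map_smul, map_smul, h1]

end IsRelFree

end Fibers

/-! ### Relatively free algebras of a primitive class -/

section Classes

variable {𝔽 : Type u} [Field 𝔽]
variable {P : Type u} [NonUnitalNonAssocRing P] [Module 𝔽 P] [IsScalarTower 𝔽 P P]
  [SMulCommClass 𝔽 P P]
variable {Q : Type u} [NonUnitalNonAssocRing Q] [Module 𝔽 Q] [IsScalarTower 𝔽 Q Q]
  [SMulCommClass 𝔽 Q Q]

variable (𝔽 P) in
/-- The algebra `P` as an object of `NAlg 𝔽`. -/
abbrev toNAlg : NAlg 𝔽 := ⟨P⟩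

theorem map_freeLift {X : Type*} (φ : P →ₙₐ[𝔽] Q) (a : X → P)
    (v : FreeNonUnitalNonAssocAlgebra 𝔽 X) :
    φ (FreeNonUnitalNonAssocAlgebra.lift 𝔽 a v) =
      FreeNonUnitalNonAssocAlgebra.lift 𝔽 (fun i => φ (a i)) v := by
  have h : φ.comp (FreeNonUnitalNonAssocAlgebra.lift 𝔽 a) =
      FreeNonUnitalNonAssocAlgebra.lift 𝔽 (fun i => φ (a i)) := by
    apply FreeNonUnitalNonAssocAlgebra.hom_ext
    intro i
    simp
  exact DFunLike.congr_fun h v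

theorem IsIdentity.of_surjective {v : FreeNonUnitalNonAssocAlgebra 𝔽 ℕ} (h : IsIdentity v P)
    (φ : P →ₙₐ[𝔽] Q) (hφ : Function.Surjective φ) : IsIdentity v Q := by
  intro a
  choose b hb using fun i => hφ (a i)
  obtain rfl : (fun i => φ (b i)) = a := funext hb
  rw [← map_freeLift, h b, map_zero]

/-- Membership in a primitive class passes to quotients. -/
theorem IsPrimitive.mem_of_surjective {C : Set (NAlg 𝔽)} (hC : IsPrimitive C)
    (hP : toNAlg 𝔽 P ∈ C) (φ : P →ₙₐ[𝔽] Q) (hφ : Function.Surjective φ) : toNAlg 𝔽 Q ∈ C := by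
  obtain ⟨V, -, rfl⟩ := hC
  exact fun v hv => (hP v hv).of_surjective φ hφ

theorem lift_mem_verbalIdeal {C : Set (NAlg 𝔽)} {v : FreeNonUnitalNonAssocAlgebra 𝔽 ℕ}
    (hv : ∀ R ∈ C, IsIdentity v R.carrier) (a : ℕ → P) :
    FreeNonUnitalNonAssocAlgebra.lift 𝔽 a v ∈ (verbalIdeal C P).toSubmodule :=
  subset_idealSpan _ ⟨v, hv, a, rfl⟩

/-- Homomorphisms to algebras of the class annul the verbal ideal. -/
theorem map_verbalIdeal {C : Set (NAlg 𝔽)} (hQ : toNAlg 𝔽 Q ∈ C) (φ : P →ₙₐ[𝔽] Q) {y : P}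
    (hy : y ∈ (verbalIdeal C P).toSubmodule) : φ y = 0 := by
  refine mem_kernel.1 (idealSpan_le (I := kernel φ) ?_ hy)
  rintro _ ⟨v, hv, a, rfl⟩
  change φ _ = 0
  rw [map_freeLift]
  exact hv _ hQ _

theorem IsPrimitive.quot_verbalIdeal_mem {C : Set (NAlg 𝔽)} (hC : IsPrimitive C) :
    toNAlg 𝔽 (verbalIdeal C P).Quot ∈ C := by
  obtain ⟨V, -, hV⟩ := hC
  have hid : ∀ v ∈ V, ∀ R ∈ C, IsIdentity v R.carrier := by
    rw [hV]
    exact fun v hv R hR => hR v hv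
  have hmem : toNAlg 𝔽 (verbalIdeal C P).Quot ∈ {R : NAlg 𝔽 | ∀ v ∈ V, IsIdentity v R.carrier} := by
    intro v hv a
    choose b hb using fun i => (verbalIdeal C P).projHom_surjective (a i)
    obtain rfl : (fun i => (verbalIdeal C P).projHom (b i)) = a := funext hb
    rw [← map_freeLift, AlgIdeal.projHom_eq_zero]
    exact lift_mem_verbalIdeal (hid v hv) b
  rwa [← hV] at hmem

theorem span_lift_freeOf (X : Type*) : Submodule.span 𝔽
    (Set.range (FreeMagma.lift (FreeNonUnitalNonAssocAlgebra.of 𝔽 : X → _))) = ⊤ := by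
  refine mem_span_of_adjoin ?_
  rw [eq_top_iff]
  intro y _
  set A := NonUnitalAlgebra.adjoin 𝔽
    (Set.range (FreeNonUnitalNonAssocAlgebra.of 𝔽 : X → FreeNonUnitalNonAssocAlgebra 𝔽 X))
  let f : FreeNonUnitalNonAssocAlgebra 𝔽 X →ₙₐ[𝔽] A := FreeNonUnitalNonAssocAlgebra.lift 𝔽
    fun i => ⟨FreeNonUnitalNonAssocAlgebra.of 𝔽 i, NonUnitalAlgebra.subset_adjoin 𝔽 ⟨i, rfl⟩⟩
  have h : (NonUnitalSubalgebraClass.subtype A).comp f = NonUnitalAlgHom.id 𝔽 _ := by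
    apply FreeNonUnitalNonAssocAlgebra.hom_ext
    intro i
    simp [f]
  have hy : (f y : FreeNonUnitalNonAssocAlgebra 𝔽 X) = y := DFunLike.congr_fun h y
  rw [← hy]
  exact (f y).2

theorem surjective_of_adjoin {X : Type*} {x : X → Q}
    (hx : NonUnitalAlgebra.adjoin 𝔽 (Set.range x) = ⊤) (φ : P →ₙₐ[𝔽] Q)
    (hφ : Set.range x ⊆ Set.range φ) : Function.Surjective φ := by
  intro y
  have h : NonUnitalAlgebra.adjoin 𝔽 (Set.range x) ≤ NonUnitalAlgHom.range φ :=
    NonUnitalAlgebra.adjoin_le hφ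
  rw [hx] at h
  exact h (x := y) trivial

theorem adjoin_of_span {X : Type*} {x : X → P}
    (hx : Submodule.span 𝔽 (Set.range (FreeMagma.lift x)) = ⊤) :
    NonUnitalAlgebra.adjoin 𝔽 (Set.range x) = ⊤ := by
  rw [eq_top_iff]
  have h : Submodule.span 𝔽 (Set.range (FreeMagma.lift x)) ≤
      (NonUnitalAlgebra.adjoin 𝔽 (Set.range x)).toSubmodule := by
    refine Submodule.span_le.2 ?_
    rintro _ ⟨w, rfl⟩
    change FreeMagma.lift x w ∈ NonUnitalAlgebra.adjoin 𝔽 (Set.range x)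
    induction w with
    | ih1 i => exact NonUnitalAlgebra.subset_adjoin 𝔽 ⟨i, rfl⟩
    | ih2 a b ha hb => rw [map_mul]; exact mul_mem ha hb
  rw [hx] at h
  exact fun y _ => h (x := y) trivial

theorem span_lift_of_surjective {X : Type*} {x : X → P}
    (hx : Submodule.span 𝔽 (Set.range (FreeMagma.lift x)) = ⊤) (φ : P →ₙₐ[𝔽] Q)
    (hφ : Function.Surjective φ) :
    Submodule.span 𝔽 (Set.range (FreeMagma.lift fun i => φ (x i))) = ⊤ := by
  have h : Set.range (FreeMagma.lift fun i => φ (x i)) =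
      (φ : P →ₗ[𝔽] Q) '' Set.range (FreeMagma.lift x) := by
    rw [← Set.range_comp]
    congr 1
    funext w
    exact (map_lift φ x w).symm
  rw [h, Submodule.span_image, hx, Submodule.map_top, LinearMap.range_eq_top]
  exact hφ

variable (C : Set (NAlg 𝔽)) (n : ℕ)

/-- The projection of the absolutely free algebra onto the relatively free algebra. -/
noncomputable def freeProj : FreeNonUnitalNonAssocAlgebra 𝔽 (Fin n) →ₙₐ[𝔽] RelFree C n :=
  (verbalIdeal C _).projHom

theorem freeProj_surjective : Function.Surjective (freeProj C n) := AlgIdeal.projHom_surjective _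

theorem freeProj_eq_zero {y} :
    freeProj C n y = 0 ↔
      y ∈ (verbalIdeal C (FreeNonUnitalNonAssocAlgebra 𝔽 (Fin n))).toSubmodule :=
  AlgIdeal.projHom_eq_zero

/-- The free generators of the relatively free algebra. -/
noncomputable def relGen (i : Fin n) : RelFree C n :=
  freeProj C n (FreeNonUnitalNonAssocAlgebra.of 𝔽 i)

variable {C}

theorem exists_hom_relFree (hQ : toNAlg 𝔽 Q ∈ C) (f : Fin n → Q) :
    ∃ φ : RelFree C n →ₙₐ[𝔽] Q, ∀ i, φ (relGen C n i) = f i := by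
  obtain ⟨φ, hφ⟩ := exists_factor (freeProj C n) (freeProj_surjective C n)
    (FreeNonUnitalNonAssocAlgebra.lift 𝔽 f) fun y hy =>
      map_verbalIdeal hQ _ ((freeProj_eq_zero C n).1 hy)
  exact ⟨φ, fun i => by rw [relGen, hφ, FreeNonUnitalNonAssocAlgebra.lift_of_apply]⟩

theorem isRelFree_relGen (hC : IsPrimitive C) : IsRelFree 𝔽 (relGen C n) where
  span_eq_top := span_lift_of_surjective (span_lift_freeOf (Fin n)) _ (freeProj_surjective C n)
  exists_hom := exists_hom_relFree n hC.quot_verbalIdeal_mem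

theorem relFree_nilpotent (hC : IsPrimitive C) {c : ℕ} (hnil : C ⊆ nilClass 𝔽 c) :
    (power 𝔽 (RelFree C n) (c + 1)).toSubmodule = ⊥ :=
  hnil hC.quot_verbalIdeal_mem

theorem exists_quot_isomorphic (hP : toNAlg 𝔽 P ∈ C) (hgen : NGenerated 𝔽 P n) :
    ∃ J : AlgIdeal 𝔽 (RelFree C n), Isomorphic 𝔽 J.Quot P := by
  obtain ⟨y, hy⟩ := hgen
  obtain ⟨φ, hφ⟩ := exists_hom_relFree n hP y
  have hsurj : Function.Surjective φ := surjective_of_adjoin hy φ (by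
    rintro _ ⟨i, rfl⟩
    exact ⟨relGen C n i, hφ i⟩)
  exact ⟨kernel φ, isomorphic_of_surjective _ (AlgIdeal.projHom_surjective _) φ hsurj fun y =>
    AlgIdeal.projHom_eq_zero.trans mem_kernel⟩

theorem quot_mem_nGeneratedIn (hC : IsPrimitive C) (J : AlgIdeal 𝔽 (RelFree C n)) :
    toNAlg 𝔽 J.Quot ∈ nGeneratedIn C n :=
  ⟨hC.mem_of_surjective hC.quot_verbalIdeal_mem J.projHom J.projHom_surjective,
    fun i => J.projHom (relGen C n i), adjoin_of_span (span_lift_of_surjective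
      (isRelFree_relGen n hC).span_eq_top _ J.projHom_surjective)⟩

/-- If `R^k = 0` for all algebras `R` of the class, then the monomials of degree `k` are identities
of the class. -/
theorem power_le_verbalIdeal {D : Set (NAlg 𝔽)} {k : ℕ}
    (hD : ∀ R ∈ D, (power 𝔽 R.carrier k).toSubmodule = ⊥) :
    (power 𝔽 P k).toSubmodule ≤ (verbalIdeal D P).toSubmodule := by
  refine Submodule.span_le.2 ?_
  rintro _ ⟨w, hw, rfl⟩
  obtain ⟨a, u, rfl⟩ := exists_map_eq_of_nat w
  rw [length_map] at hw
  have hval : ∀ (R : Type u) [NonUnitalNonAssocRing R] [Module 𝔽 R] [IsScalarTower 𝔽 R R]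
      [SMulCommClass 𝔽 R R] (a : ℕ → R), FreeNonUnitalNonAssocAlgebra.lift 𝔽 a
        (FreeMagma.lift (FreeNonUnitalNonAssocAlgebra.of 𝔽) u) = FreeMagma.lift a u := by
    intro R _ _ _ _ a
    rw [map_lift]
    simp
  have h := lift_mem_verbalIdeal (C := D) (P := P)
    (v := FreeMagma.lift (FreeNonUnitalNonAssocAlgebra.of 𝔽) u) (fun R hR b => by
      rw [hval]
      have hb : FreeMagma.lift b u ∈ (power 𝔽 R.carrier k).toSubmodule :=
        Submodule.subset_span ⟨FreeMagma.map b u, by rw [length_map, hw], lift_map _ _ _⟩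
      rwa [hD R hR, Submodule.mem_bot] at hb) a
  rw [hval] at h
  rw [monomialValue, lift_map]
  exact h

/-- A quotient of `RelFree C n` by an ideal contained in the last power `RelFree C n ^ c` becomes
relatively free in the class `C ∩ 𝔑_(c-1)` when its own `c`-th power is factored out. -/
theorem quot_mem_quotientFree (hC : IsPrimitive C) {c : ℕ} (hc : 1 ≤ c)
    {J : AlgIdeal 𝔽 (RelFree C n)} (hJ : J.toSubmodule ≤ (power 𝔽 (RelFree C n) c).toSubmodule) :
    toNAlg 𝔽 J.Quot ∈ quotientFree (C ∩ nilClass 𝔽 (c - 1)) c n := by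
  have hc' : c - 1 + 1 = c := by omega
  set D := C ∩ nilClass 𝔽 (c - 1)
  let φ : FreeNonUnitalNonAssocAlgebra 𝔽 (Fin n) →ₙₐ[𝔽] (power 𝔽 J.Quot c).Quot :=
    ((power 𝔽 J.Quot c).projHom.comp J.projHom).comp (freeProj C n)
  have hφ : Function.Surjective φ := ((AlgIdeal.projHom_surjective _).comp
    J.projHom_surjective).comp (freeProj_surjective C n)
  have hmem : toNAlg 𝔽 (power 𝔽 J.Quot c).Quot ∈ D := by
    refine ⟨hC.mem_of_surjective (quot_mem_nGeneratedIn n hC J).1 _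
      (AlgIdeal.projHom_surjective _), ?_⟩
    change (power 𝔽 (power 𝔽 J.Quot c).Quot (c - 1 + 1)).toSubmodule = ⊥
    rw [hc', eq_bot_iff]
    intro z hz
    obtain ⟨y, hy, rfl⟩ := exists_mem_power_of_surjective _ (AlgIdeal.projHom_surjective _) hz
    exact AlgIdeal.projHom_eq_zero.2 hy
  refine isomorphic_of_surjective φ hφ (freeProj D n) (freeProj_surjective D n) fun y =>
    ⟨fun hy => ?_, fun hy => map_verbalIdeal hmem φ ((freeProj_eq_zero D n).1 hy)⟩
  -- `y` lies in the sum of the verbal ideal of `C` and the `c`-th power of the free algebra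
  have h1 : J.projHom (freeProj C n y) ∈ (power 𝔽 J.Quot c).toSubmodule :=
    AlgIdeal.projHom_eq_zero.1 hy
  obtain ⟨z, hz, hzy⟩ := exists_mem_power_of_surjective _ J.projHom_surjective h1
  have h2 : freeProj C n y ∈ (power 𝔽 (RelFree C n) c).toSubmodule := by
    have h3 := hJ (AlgIdeal.projHom_eq.1 hzy)
    have h4 := Submodule.sub_mem _ hz h3
    rwa [sub_sub_cancel] at h4
  obtain ⟨z, hz, hzy⟩ := exists_mem_power_of_surjective _ (freeProj_surjective C n) h2
  have h3 : y - z ∈ (verbalIdeal C (FreeNonUnitalNonAssocAlgebra 𝔽 (Fin n))).toSubmodule := by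
    rw [← freeProj_eq_zero, map_sub, hzy, sub_self]
  have h4 : z ∈ (verbalIdeal D (FreeNonUnitalNonAssocAlgebra 𝔽 (Fin n))).toSubmodule := by
    refine power_le_verbalIdeal (fun R hR => ?_) hz
    have := hR.2
    change (power 𝔽 R.carrier (c - 1 + 1)).toSubmodule = ⊥ at this
    rwa [hc'] at this
  have h5 : y - z ∈ (verbalIdeal D (FreeNonUnitalNonAssocAlgebra 𝔽 (Fin n))).toSubmodule := by
    refine idealSpan_le ?_ h3
    rintro _ ⟨v, hv, a, rfl⟩
    exact lift_mem_verbalIdeal (fun R hR => hv R hR.1) a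
  rw [freeProj_eq_zero, ← sub_add_cancel y z]
  exact Submodule.add_mem _ h5 h4

end Classes
/-! ### Comparison of isomorphism classes -/

section Comparison

variable {𝔽 : Type u} [Field 𝔽] {C : Set (NAlg 𝔽)}

/-- The isomorphism class of the quotient of the relatively free algebra by an ideal. -/
noncomputable def quotClass {n : ℕ} (J : AlgIdeal 𝔽 (RelFree C n)) :
    Quotient (isoSetoid (𝔽 := 𝔽)) :=
  Quotient.mk isoSetoid (toNAlg 𝔽 J.Quot)

theorem isomorphic_of_quotClass_eq {n : ℕ} {J K : AlgIdeal 𝔽 (RelFree C n)}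
    (h : quotClass J = quotClass K) : Isomorphic 𝔽 J.Quot K.Quot := Quotient.exact h

theorem isoClasses_nGeneratedIn (hC : IsPrimitive C) (n : ℕ) :
    isoClasses (nGeneratedIn C n) = Set.range (quotClass (C := C) (n := n)) := by
  ext q
  constructor
  · rintro ⟨R, ⟨hR, hgen⟩, rfl⟩
    obtain ⟨J, hJ⟩ := exists_quot_isomorphic n (P := R.carrier) hR hgen
    exact ⟨J, Quotient.sound hJ⟩
  · rintro ⟨J, rfl⟩
    exact ⟨_, quot_mem_nGeneratedIn n hC J, rfl⟩

theorem quotClass_mem_of_le (hC : IsPrimitive C) {c n : ℕ} (hc : 1 ≤ c)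
    {J : AlgIdeal 𝔽 (RelFree C n)} (hJ : J.toSubmodule ≤ (power 𝔽 (RelFree C n) c).toSubmodule) :
    quotClass J ∈ isoClasses (nGeneratedIn C n ∩
      quotientFree (C ∩ nilClass 𝔽 (c - 1)) c n) :=
  ⟨_, ⟨quot_mem_nGeneratedIn n hC J, quot_mem_quotientFree n hC hc hJ⟩, rfl⟩

variable [Finite 𝔽]

/-- The subspaces of `RelFree C n ^ c` fall into not too few isomorphism classes of quotients: an
isomorphism between two such quotients is determined by the images of the generators modulo the
annihilator. -/
theorem card_submodule_le_card_mul_pow (hC : IsPrimitive C) {c n : ℕ} (hc : 2 ≤ c)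
    (hnil : C ⊆ nilClass 𝔽 c)
    (hcentral : annihilator 𝔽 (RelFree C n) = power 𝔽 (RelFree C n) c)
    {T : Set (Quotient (isoSetoid (𝔽 := 𝔽)))} (hTfin : T.Finite)
    (hT : ∀ J : AlgIdeal 𝔽 (RelFree C n),
      J.toSubmodule ≤ (power 𝔽 (RelFree C n) c).toSubmodule → quotClass J ∈ T) :
    Nat.card (Submodule 𝔽 (power 𝔽 (RelFree C n) c).toSubmodule) ≤
      T.ncard * Nat.card 𝔽 ^ ((Module.finrank 𝔽 (RelFree C n) -
        Module.finrank 𝔽 (power 𝔽 (RelFree C n) c).toSubmodule) * n) := by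
  have hx := isRelFree_relGen n hC
  have := hx.finiteDimensional (relFree_nilpotent n hC hnil)
  set A := (power 𝔽 (RelFree C n) c).toSubmodule with hA
  have hAnn : (annihilator 𝔽 (RelFree C n)).toSubmodule = A := by rw [hcentral]
  have := finite_submodule 𝔽 A
  have := finite_of_finiteDimensional 𝔽 (RelFree C n ⧸ A)
  have hle : ∀ K : Submodule 𝔽 A, K.map A.subtype ≤ A := fun K => Submodule.map_subtype_le _ _
  let ideal : Submodule 𝔽 A → AlgIdeal 𝔽 (RelFree C n) := fun K =>
    idealOfLe (K.map A.subtype) ((hle K).trans hAnn.ge)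
  let f : Submodule 𝔽 A → T := fun K => ⟨quotClass (ideal K), hT _ (hle K)⟩
  -- a representative of each fibre of the map from subspaces to classes
  let rep : Submodule 𝔽 A → Submodule 𝔽 A := fun K => Function.invFun f (f K)
  have hrep : ∀ K, f (rep K) = f K := fun K => Function.invFun_eq ⟨K, rfl⟩
  have hlift : ∀ K, ∃ α : RelFree C n →ₙₐ[𝔽] RelFree C n, ∀ y,
      y ∈ (ideal K).toSubmodule ↔ α y ∈ (ideal (rep K)).toSubmodule := fun K =>
    hx.exists_lift_of_isomorphic
      (isomorphic_of_quotClass_eq (congrArg Subtype.val (hrep K)).symm)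
  choose α hα using hlift
  let code : Submodule 𝔽 A → T × (Fin n → RelFree C n ⧸ A) := fun K =>
    (f K, fun i => A.mkQ (α K (relGen C n i)))
  have hcode : Function.Injective code := by
    intro K L h
    have h1 : f K = f L := congrArg Prod.fst h
    have h2 : rep K = rep L := congrArg (Function.invFun f) h1
    have h3 : ∀ y ∈ A, α K y = α L y := fun y hy =>
      hx.eq_on_power_of_sub_mem hc (fun i => by
        rw [hAnn]
        exact (Submodule.Quotient.eq A).1 (congrFun (congrArg Prod.snd h) i)) hy
    have h4 : K.map A.subtype = L.map A.subtype := by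
      ext y
      have hK := hα K y
      have hL := hα L y
      rw [← h2] at hL
      constructor
      · intro hy
        exact hL.2 (h3 y (hle K hy) ▸ hK.1 hy)
      · intro hy
        exact hK.2 ((h3 y (hle L hy)).symm ▸ hL.1 hy)
    exact Submodule.map_injective_of_injective A.injective_subtype h4
  have := hTfin.to_subtype
  refine (Nat.card_le_card_of_injective code hcode).trans (le_of_eq ?_)
  rw [Nat.card_prod, Nat.card_fun, Nat.card_fin,
    Module.natCard_eq_pow_finrank (K := 𝔽) (V := RelFree C n ⧸ A), ← pow_mul,
    Nat.card_coe_set_eq]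
  congr 3
  have := A.finrank_quotient_add_finrank
  omega

theorem numMonomials_pos {c : ℕ} (hc : 1 ≤ c) : 0 < numMonomials c :=
  (Set.ncard_pos (finite_length_le (Fin c) c)).2 ⟨FreeMagma.of ⟨0, hc⟩, hc⟩

/-- The last power is a proper subspace: otherwise it would be annihilated by the whole algebra, so
that it would vanish, whereas the class contains nonzero algebras. -/
theorem finrank_power_lt (hC : IsPrimitive C) {c n : ℕ} (hc : 2 ≤ c) (hn : 1 ≤ n)
    (hnil : IsStepNilpotent C c)
    (hcentral : annihilator 𝔽 (RelFree C n) = power 𝔽 (RelFree C n) c) :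
    Module.finrank 𝔽 (power 𝔽 (RelFree C n) c).toSubmodule <
      Module.finrank 𝔽 (RelFree C n) := by
  have hx := isRelFree_relGen n hC
  have := hx.finiteDimensional (relFree_nilpotent n hC hnil.1)
  refine Submodule.finrank_lt fun htop => ?_
  have hbot : (power 𝔽 (RelFree C n) c).toSubmodule = ⊥ := by
    rw [power_eq_span hx.span_eq_top (by omega), eq_bot_iff]
    refine Submodule.span_le.2 ?_
    rintro _ ⟨w, hw, rfl⟩
    have hw : c ≤ w.length := hw
    induction w with
    | ih1 i => change c ≤ 1 at hw; omega
    | ih2 a b _ _ =>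
      have h : FreeMagma.lift (relGen C n) b ∈
          (annihilator 𝔽 (RelFree C n)).toSubmodule := by
        rw [hcentral, htop]; trivial
      rw [map_mul]
      exact (h _).1
  obtain ⟨R, hR, hRc⟩ := hnil.2
  obtain ⟨p, -, hp⟩ := Submodule.exists_mem_ne_zero_of_ne_bot hRc
  obtain ⟨φ, hφ⟩ := exists_hom_relFree n (Q := R.carrier) hR fun _ => p
  have h0 : relGen C n ⟨0, hn⟩ ∈ (power 𝔽 (RelFree C n) c).toSubmodule := by rw [htop]; trivial
  rw [hbot, Submodule.mem_bot] at h0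
  exact hp (by rw [← hφ ⟨0, hn⟩, h0, map_zero])

/-- The ideals not contained in the last power are outnumbered by the classes in `T n`, by a factor
exponential in the rank `n`. -/
theorem exists_card_not_le_mul_pow_le (hC : IsPrimitive C) {c : ℕ} (hc : 2 ≤ c)
    (hnil : IsStepNilpotent C c) (hcentral : IsCentral C c)
    {T : ℕ → Set (Quotient (isoSetoid (𝔽 := 𝔽)))} (hTfin : ∀ n, (T n).Finite)
    (hT : ∀ n, ∀ J : AlgIdeal 𝔽 (RelFree C n),
      J.toSubmodule ≤ (power 𝔽 (RelFree C n) c).toSubmodule → quotClass J ∈ T n) :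
    ∃ k N : ℕ, 0 < k ∧ ∀ n, N ≤ n → ∃ D : ℕ, n ≤ k * D ∧
      Nat.card {J : AlgIdeal 𝔽 (RelFree C n) //
        ¬ J.toSubmodule ≤ (power 𝔽 (RelFree C n) c).toSubmodule} * 2 ^ D ≤ (T n).ncard := by
  -- `n ≤ 3 c m` for `m = (n - c) / c`, hence `n d ≤ k D` by `d m ≤ Λ D`; the summand `3` in `M`
  -- makes up for the factor `2 D ≤ q ^ (2 D)` and for the gain `q ^ D`
  set Λ := c * numMonomials c * 2 ^ c with hΛdef
  have hΛ : 0 < Λ := Nat.mul_pos (Nat.mul_pos (by omega) (numMonomials_pos (by omega)))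
    (Nat.two_pow_pos c)
  set k := 3 * c * Λ with hk
  set M := k + 3 with hM
  have hk0 : 0 < k := Nat.mul_pos (by omega) hΛ
  set B := 8 * (M + 2) * Λ + 2 ^ c with hB
  refine ⟨k, c * B + c, hk0, fun n hn => ?_⟩
  have hBpos : 0 < B := Nat.add_pos_right _ (Nat.two_pow_pos c)
  have hcB : c ≤ c * B := Nat.le_mul_of_pos_right _ hBpos
  set m := (n - c) / c with hm
  have hmB : B ≤ m := by
    rw [hm, Nat.le_div_iff_mul_le (by omega), mul_comm]
    omega
  have hnm : n ≤ 3 * c * m := by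
    have h1 : n - c < c * (m + 1) := by
      rw [hm]; exact Nat.lt_mul_div_succ _ (by omega)
    have h2 : c * 1 ≤ c * m := Nat.mul_le_mul_left _ (by omega)
    have h3 : 3 * c * m = c * m + c * m + c * m := by ring
    have h4 : c * (m + 1) = c * m + c := by ring
    omega
  have hcent := hcentral n (by omega)
  have hx := isRelFree_relGen n hC
  have hnil' := relFree_nilpotent n hC hnil.1
  have := hx.finiteDimensional hnil'
  have hlt := finrank_power_lt hC hc (n := n) (by omega) hnil hcent
  have hG := card_submodule_le_card_mul_pow hC hc hnil.1 hcent (hTfin n) (hT n)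
  set A := (power 𝔽 (RelFree C n) c).toSubmodule with hA
  set D := Module.finrank 𝔽 A with hD
  set d := Module.finrank 𝔽 (RelFree C n) - D with hd
  have hkey : ∀ J : AlgIdeal 𝔽 (RelFree C n), excess A J * m ≤
      Λ * Module.finrank 𝔽 (J.toSubmodule ⊓ A : Submodule 𝔽 (RelFree C n)) := fun J =>
    hx.finrank_ideal_le hnil' (by rw [hcent]) (by omega) (by omega) (by omega) J
  have hdm : d * m ≤ Λ * D := by
    have h := hkey (power 𝔽 (RelFree C n) 1)
    rwa [excess, power_one, top_inf_eq, finrank_top] at h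
  have hdD : d ≤ D := by
    refine Nat.le_of_mul_le_mul_left (le_trans ?_ hdm) hΛ
    rw [mul_comm]
    refine Nat.mul_le_mul_left _ (le_trans ?_ (le_trans (Nat.le_add_right _ _) hmB))
    exact Nat.le_mul_of_pos_left _ (by omega)
  have hnd : n * d ≤ k * D := by
    calc n * d ≤ 3 * c * m * d := Nat.mul_le_mul_right _ hnm
      _ = 3 * c * (d * m) := by ring
      _ ≤ 3 * c * (Λ * D) := Nat.mul_le_mul_left _ hdm
      _ = k * D := by rw [hk]; ring
  have hd1 : 1 ≤ d := by omega
  refine ⟨D, (Nat.le_mul_of_pos_right n hd1).trans hnd, ?_⟩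
  have hcount := card_not_le_mul_pow_le (A := A) (M := M) hΛ
    ((Nat.le_add_right _ _).trans hmB) (by omega) hkey
  rw [← hD] at hcount
  set q := Nat.card 𝔽 with hq
  have hq2 : 2 ≤ q := Finite.one_lt_card
  set X := Nat.card {J : AlgIdeal 𝔽 (RelFree C n) // ¬ J.toSubmodule ≤ A}
  set G := Nat.card (Submodule 𝔽 A)
  have hqD : 0 < q ^ (k * D + D + D) := pow_pos (by omega) _
  have h2D : D * 2 ≤ q ^ D * q ^ D := by
    have h1 : D < q ^ D := Nat.lt_pow_self (by omega)
    have h2 : 2 ≤ q ^ D := hq2.trans (Nat.le_self_pow (by omega) q)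
    exact Nat.mul_le_mul h1.le h2
  have hX : X * q ^ D * q ^ (k * D + D + D) ≤ (T n).ncard * q ^ (k * D + D + D) := by
    calc X * q ^ D * q ^ (k * D + D + D) = X * q ^ (D * M) := by
          rw [mul_assoc, ← pow_add]
          congr 2
          rw [hM]; ring
      _ ≤ D * (2 * G) := hcount
      _ = D * 2 * G := by ring
      _ ≤ q ^ D * q ^ D * ((T n).ncard * q ^ (k * D)) := by
          refine Nat.mul_le_mul h2D (hG.trans (Nat.mul_le_mul_left _ ?_))
          exact Nat.pow_le_pow_right (by omega) (by rw [mul_comm]; exact hnd)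
      _ = (T n).ncard * q ^ (k * D + D + D) := by rw [pow_add, pow_add]; ring
  refine le_trans ?_ (Nat.le_of_mul_le_mul_right hX hqD)
  exact Nat.mul_le_mul_left _ (Nat.pow_le_pow_left hq2 D)

end Comparison

end NilpotentGeneric

theorem mainTheorem9 {𝔽 : Type u} [Field 𝔽] [Finite 𝔽] (c : ℕ) (hc : 2 ≤ c)
    (C : Set (NilpotentGeneric.NAlg 𝔽)) (hprim : NilpotentGeneric.IsPrimitive C)
    (hnil : NilpotentGeneric.IsStepNilpotent C c) (hcentral : NilpotentGeneric.IsCentral C c)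
    (S T : ℕ → Set (Quotient (NilpotentGeneric.isoSetoid (𝔽 := 𝔽))))
    (hS : ∀ n, S n = NilpotentGeneric.isoClasses (NilpotentGeneric.nGeneratedIn C n))
    (hT : ∀ n, T n = NilpotentGeneric.isoClasses (NilpotentGeneric.nGeneratedIn C n ∩
      NilpotentGeneric.quotientFree (C ∩ NilpotentGeneric.nilClass 𝔽 (c - 1)) c n)) :
    (∀ n, (S n).Finite) ∧
    Tendsto (fun n : ℕ => ((T n).ncard : ℝ) / ((S n).ncard : ℝ)) atTop (𝓝 1) ∧
    ∃ r : ℝ, 0 ≤ r ∧ r < 1 ∧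
      ∀ᶠ n : ℕ in atTop, 1 - r ^ n < ((T n).ncard : ℝ) / ((S n).ncard : ℝ) := by
  open NilpotentGeneric in
  have hfinJ : ∀ n, Finite (AlgIdeal 𝔽 (RelFree C n)) := fun n =>
    have := (isRelFree_relGen n hprim).finiteDimensional (relFree_nilpotent n hprim hnil.1)
    finite_algIdeal 𝔽 _
  have hSrange : ∀ n, S n = Set.range (quotClass (C := C) (n := n)) := fun n => by
    rw [hS, isoClasses_nGeneratedIn hprim]
  have hSfin : ∀ n, (S n).Finite := fun n => by
    rw [hSrange]; exact Set.finite_range _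
  have hTS : ∀ n, T n ⊆ S n := fun n => by
    rw [hS, hT]; exact Set.image_mono Set.inter_subset_left
  have hTfin : ∀ n, (T n).Finite := fun n => (hSfin n).subset (hTS n)
  have hTmem : ∀ n, ∀ J : AlgIdeal 𝔽 (RelFree C n),
      J.toSubmodule ≤ (power 𝔽 (RelFree C n) c).toSubmodule → quotClass J ∈ T n := by
    intro n J hJ
    rw [hT]
    exact quotClass_mem_of_le hprim (by omega) hJ
  have hTpos : ∀ n, 0 < (T n).ncard := fun n =>
    (Set.ncard_pos (hTfin n)).2 ⟨_, hTmem n (power 𝔽 (RelFree C n) c) le_rfl⟩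
  have hScard : ∀ n, (S n).ncard ≤ (T n).ncard + Nat.card {J : AlgIdeal 𝔽 (RelFree C n) //
      ¬ J.toSubmodule ≤ (power 𝔽 (RelFree C n) c).toSubmodule} := by
    intro n
    have hsub : S n ⊆ T n ∪ quotClass '' {J : AlgIdeal 𝔽 (RelFree C n) |
        ¬ J.toSubmodule ≤ (power 𝔽 (RelFree C n) c).toSubmodule} := by
      rw [hSrange]
      rintro _ ⟨J, rfl⟩
      by_cases hJ : J.toSubmodule ≤ (power 𝔽 (RelFree C n) c).toSubmodule
      · exact Or.inl (hTmem n J hJ)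
      · exact Or.inr ⟨J, hJ, rfl⟩
    refine (Set.ncard_le_ncard hsub ((hTfin n).union (Set.toFinite _))).trans
      ((Set.ncard_union_le _ _).trans (Nat.add_le_add_left ?_ _))
    exact (Set.ncard_image_le (Set.toFinite _)).trans (le_of_eq (Nat.card_coe_set_eq _).symm)
  obtain ⟨k, N, hk, hbound⟩ := exists_card_not_le_mul_pow_le hprim hc hnil hcentral hTfin hTmem
  -- by Bernoulli's inequality `r ^ k ≥ 1 / 2`
  set r : ℝ := 1 - 1 / (2 * k) with hr
  have hkR : (1 : ℝ) ≤ k := by exact_mod_cast hk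
  have hinv : 1 / (2 * (k : ℝ)) ≤ 1 / 2 := by
    rw [div_le_div_iff₀ (by linarith) (by norm_num)]; linarith
  have hinv0 : 0 < 1 / (2 * (k : ℝ)) := by positivity
  have hr0 : 0 ≤ r := by rw [hr]; linarith
  have hr1 : r < 1 := by rw [hr]; linarith
  have hrk : 1 / 2 ≤ r ^ k := by
    have h := one_add_mul_le_pow (a := -(1 / (2 * (k : ℝ)))) (by linarith) k
    have h2 : (k : ℝ) * -(1 / (2 * (k : ℝ))) = -(1 / 2) := by
      field_simp
    rw [h2, ← sub_eq_add_neg, ← sub_eq_add_neg] at h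
    rw [hr]
    linarith
  have hlower : ∀ n, N ≤ n → 1 - r ^ n < ((T n).ncard : ℝ) / ((S n).ncard : ℝ) := by
    intro n hn
    obtain ⟨D, hnD, hD⟩ := hbound n hn
    have h1 := hScard n
    have h2 := hTpos n
    set X := Nat.card {J : AlgIdeal 𝔽 (RelFree C n) //
      ¬ J.toSubmodule ≤ (power 𝔽 (RelFree C n) c).toSubmodule}
    have hT0 : (0 : ℝ) < (T n).ncard := by exact_mod_cast h2
    have hS0 : (0 : ℝ) < (S n).ncard := by
      exact_mod_cast h2.trans_le (Set.ncard_le_ncard (hTS n) (hSfin n))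
    have hSX : ((S n).ncard : ℝ) ≤ (T n).ncard + X := by exact_mod_cast h1
    have hX0 : (0 : ℝ) ≤ X := Nat.cast_nonneg _
    have hrn : (1 / 2 : ℝ) ^ D ≤ r ^ n := by
      calc (1 / 2 : ℝ) ^ D ≤ (r ^ k) ^ D := pow_le_pow_left₀ (by norm_num) hrk D
        _ = r ^ (k * D) := (pow_mul r k D).symm
        _ ≤ r ^ n := pow_le_pow_of_le_one hr0 hr1.le hnD
    have hXT : (X : ℝ) ≤ (1 / 2) ^ D * (T n).ncard := by
      have h3 : (X : ℝ) * 2 ^ D ≤ (T n).ncard := by exact_mod_cast hD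
      rw [one_div, inv_pow, inv_mul_eq_div, le_div_iff₀ (by positivity)]
      exact h3
    have hε : (0 : ℝ) < (1 / 2) ^ D := by positivity
    rw [lt_div_iff₀ hS0]
    have h4 : ((S n).ncard : ℝ) ≤ (T n).ncard * (1 + (1 / 2) ^ D) := by linarith
    calc (1 - r ^ n) * ((S n).ncard : ℝ) ≤ (1 - (1 / 2) ^ D) * (S n).ncard :=
          mul_le_mul_of_nonneg_right (by linarith) hS0.le
      _ ≤ (1 - (1 / 2) ^ D) * ((T n).ncard * (1 + (1 / 2) ^ D)) := by
          refine mul_le_mul_of_nonneg_left h4 ?_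
          have : (1 / 2 : ℝ) ^ D ≤ 1 := pow_le_one₀ (by norm_num) (by norm_num)
          linarith
      _ = (T n).ncard - (T n).ncard * ((1 / 2) ^ D) ^ 2 := by ring
      _ < (T n).ncard := by
          have : 0 < ((T n).ncard : ℝ) * ((1 / 2) ^ D) ^ 2 := by positivity
          linarith
  have hupper : ∀ n, ((T n).ncard : ℝ) / ((S n).ncard : ℝ) ≤ 1 := fun n =>
    div_le_one_of_le₀ (by exact_mod_cast Set.ncard_le_ncard (hTS n) (hSfin n))
      (Nat.cast_nonneg _)
  refine ⟨hSfin, ?_, r, hr0, hr1, eventually_atTop.2 ⟨N, hlower⟩⟩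
  refine tendsto_of_tendsto_of_tendsto_of_le_of_le' (g := fun n => 1 - r ^ n) (h := fun _ => 1)
    ?_ tendsto_const_nhds (eventually_atTop.2 ⟨N, fun n hn => (hlower n hn).le⟩)
    (Eventually.of_forall hupper)
  simpa using (tendsto_pow_atTop_nhds_zero_of_lt_one hr0 hr1).const_sub 1
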